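/- Let $X_1,X_2,\dots$ be i.i.d. real random variables with common law $F$, let $m\ge 1$, and let $h:\mathbb{R}^m\to\mathbb{R}$ be a Borel measurable function that is symmetric in its arguments. Put $\theta=\int h\,dF\cdots dF$ and $\tilde h_1(x)=\mathbb{E}\big(h(X_1,\dots,X_m)-\theta\mid X_1=x\big)=\int\big(h(x,x_2,\dots,x_m)-\theta\big)\,dF(x_2)\cdots dF(x_m)$. Let $$U_n=\binom{n}{m}^{-1}\sum_{1\le j_1<\dots<j_m\le n}h(X_{j_1},\dots,X_{j_m}),\qquad U^i_{n-1}=\binom{n-1}{m}^{-1}\sum_{\substack{1\le j_1<\dots<j_m\le n\\ j_1,\dots,j_m\ne i}}h(X_{j_1},\dots,X_{j_m}).$$ Assume that $\mathbb{E}|h(X_1,\dots,X_m)|^{5/3}<\infty$ and that $\tilde h_1(X_1)$ is in the domain of attraction of the normal law, i.e. there are constants $A_n$ and $B_n>0$ such that $B_n^{-1}\big(\sum_{i=1}^n\tilde h_1(X_i)-A_n\big)$ converges in distribution to $N(0,1)$. Let $\ell(n)=n^{-1/2}B_n$ for any such choice of constants $A_n$, $B_n>0$ (in particular, $\ell$ may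 be the slowly varying normalising function of $\tilde h_1(X_1)$, for which one can take $A_n=0$). Then, as $n\to\infty$, $$\left|\frac{n-1}{m^2\,\ell^2(n)}\sum_{i=1}^n\big(U^i_{n-1}-U_n\big)^2-\frac{1}{n\,\ell^2(n)}\sum_{i=1}^n\tilde h_1^2(X_i)\right|\longrightarrow 0\quad\text{in probability.}$$ -/

import Mathlib

open MeasureTheory ProbabilityTheory Filter Finset
open scoped Topology

noncomputable section

namespace UStat

/-- Sum of the kernel `h` over all increasing `m`-tuples `i 0 < i 1 < ⋯ < i (m - 1)` of
indices taken from the finite set `s`, at the sample `x`. -/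
def kernelSum {m : ℕ} (h : (Fin m → ℝ) → ℝ) (s : Finset ℕ) (x : ℕ → ℝ) : ℝ :=
  open Classical in
  ∑ i ∈ (Fintype.piFinset (fun _ : Fin m => s)).filter StrictMono, h (fun j => x (i j))

/-- The `U`-statistic of order `m` based on the first `n` observations
`x 0, …, x (n - 1)`. -/
def uStat {m : ℕ} (h : (Fin m → ℝ) → ℝ) (n : ℕ) (x : ℕ → ℝ) : ℝ :=
  (n.choose m : ℝ)⁻¹ * kernelSum h (range n) x

/-- The jackknifed `U`-statistic: the `U`-statistic based on the `n - 1` observations that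
remain after the observation with index `i < n` is deleted. -/
def jackknife {m : ℕ} (h : (Fin m → ℝ) → ℝ) (n i : ℕ) (x : ℕ → ℝ) : ℝ :=
  ((n - 1).choose m : ℝ)⁻¹ * kernelSum h ((range n).erase i) x

/-- The parameter `θ = ∫ h dF ⋯ dF`. -/
def theta {m : ℕ} (h : (Fin m → ℝ) → ℝ) (F : Measure ℝ) : ℝ :=
  ∫ y, h y ∂(Measure.pi fun _ : Fin m => F)

/-- The projection `x ↦ E (h (X₁, …, X_m) - θ | X₁ = x)` for independent `X₁, …, X_m` with
common law `F`: the first argument is fixed at `x` and the others are integrated out (the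
integrand does not depend on `y 0`, and `F` is a probability measure). -/
def proj {m : ℕ} (h : (Fin m → ℝ) → ℝ) (F : Measure ℝ) (x : ℝ) : ℝ :=
  ∫ y, (h (fun j => if (j : ℕ) = 0 then x else y j) - theta h F)
    ∂(Measure.pi fun _ : Fin m => F)

variable {Ω : Type*} [MeasurableSpace Ω]

/-- `(Y 0 + ⋯ + Y (n - 1) - A n) / B n` converges in distribution to the standard normal law,
with `B n > 0`. -/
def NormalAttraction (P : Measure Ω) [IsProbabilityMeasure P] (Y : ℕ → Ω → ℝ)
    (A B : ℕ → ℝ) : Prop :=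
  (∀ n, 1 ≤ n → 0 < B n) ∧
    TendstoInDistribution (fun (n : ℕ) (ω : Ω) => (∑ i ∈ range n, Y i ω - A n) / B n) atTop
      (id : ℝ → ℝ) (fun _ => P) (gaussianReal 0 1)

/-- The sequence `Y` (meant to be i.i.d.) is in the domain of attraction of the normal law. -/
def DAN (P : Measure Ω) [IsProbabilityMeasure P] (Y : ℕ → Ω → ℝ) : Prop :=
  ∃ A B : ℕ → ℝ, NormalAttraction P Y A B

end UStat

end

/-! Let T_k (`averageThrough`) be the mean of the kernel over the m-sets of indices that contain k.
Deleting observation k removes exactly these sets, so the jackknife difference equals m/(n-m) * (U_n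
- T_k), and U_n is itself the mean of the T_k. Split T_k = θ + Y_k + R_k with Y_k = `proj` at X_k
and R_k the `residual`. Up to a factor tending to 1, the jackknife expression is the centred sum of
squares of the Y_k + R_k divided by n ℓ(n)^2. As soon as ℓ(n) ≥ c > 0, `abs_sum_sq_sub_le` bounds
its distance from ∑ Y_k^2 / (n ℓ(n)^2) by constants times ∑ Y_k^2 / n^(3/2), ∑ R_k^2 / √n and (∑ Y_k
/ n)^2.

The lower bound on ℓ is `NormalAttraction.exists_le`: sums of non-degenerate i.i.d. terms do not
stay tight under norming of smaller order than √n, and degenerate terms cannot have a Gaussian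
limit. The mean of the Y_k vanishes by the strong law (`tendstoInMeasure_mean_proj`).

The two sums of squares are handled by truncating h at height L^3 with L = n^(7/16). Writing I for
the 5/3-moment, the bounded part has second moment at most L * I and the tail has first moment at
most I / L^2. For the bounded part, kernels centred at their conditional mean given X_k are
uncorrelated when their index sets meet only in k, which gives E R_k^2 = O(L/n)
(`integral_residual_sq_le`). For the tail, first moments suffice because ∑ a_k^2 ≤ (∑ |a_k|)^2. -/

namespace UStat

/-! ### Kernel sums over m-subsets and the jackknife identity. -/

/-- The value of a kernel of order `m` at the observations indexed by an `m`-set `J`, listed in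
increasing order. -/
noncomputable def kernelOn {m : ℕ} (h : (Fin m → ℝ) → ℝ) (J : Finset ℕ) (x : ℕ → ℝ) : ℝ :=
  if hJ : #J = m then h (fun j => x (J.orderEmbOfFin hJ j)) else 0

/-- By symmetry of h, any enumeration of the set may replace the increasing one; later this allows a
chosen index k to be listed first. -/
theorem kernelOn_image {m : ℕ} {h : (Fin m → ℝ) → ℝ}
    (hsymm : ∀ (σ : Equiv.Perm (Fin m)) (x : Fin m → ℝ), h (fun j => x (σ j)) = h x)
    {i : Fin m → ℕ} (hi : Function.Injective i) (x : ℕ → ℝ) :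
    kernelOn h (univ.image i) x = h (fun j => x (i j)) := by
  have hJ : #(univ.image i) = m := by simp [card_image_of_injective _ hi]
  have hmem (j : Fin m) : i j ∈ univ.image i := mem_image_of_mem _ (mem_univ j)
  let f : Fin m → Fin m := fun j => ((univ.image i).orderIsoOfFin hJ).symm ⟨i j, hmem j⟩
  have hf : Function.Injective f := fun a b hab => by
    simpa [f] using hi (by simpa [f] using hab)
  let σ : Equiv.Perm (Fin m) := Equiv.ofBijective f (Finite.injective_iff_bijective.1 hf)
  have hσ (j : Fin m) : (univ.image i).orderEmbOfFin hJ (σ j) = i j := by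
    simp [σ, f, orderEmbOfFin]
  rw [kernelOn, dif_pos hJ, ← hsymm σ]
  simp only [hσ]

theorem kernelSum_eq_sum_powersetCard {m : ℕ} (h : (Fin m → ℝ) → ℝ) (s : Finset ℕ) (x : ℕ → ℝ) :
    kernelSum h s x = ∑ J ∈ powersetCard m s, kernelOn h J x := by
  classical
  unfold kernelSum
  symm
  refine sum_bij' (fun J hJ => (J.orderEmbOfFin (mem_powersetCard.1 hJ).2 : Fin m → ℕ))
    (fun i _ => univ.image i) ?_ ?_ ?_ ?_ ?_
  · intro J hJ
    have := mem_powersetCard.1 hJ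
    simp only [mem_filter, Fintype.mem_piFinset]
    exact ⟨fun j => this.1 (orderEmbOfFin_mem _ _ _), (J.orderEmbOfFin _).strictMono⟩
  · intro i hi
    simp only [mem_filter, Fintype.mem_piFinset] at hi
    refine mem_powersetCard.2 ⟨fun a ha => ?_, by
      simp [card_image_of_injective _ hi.2.injective]⟩
    obtain ⟨j, -, rfl⟩ := mem_image.1 ha
    exact hi.1 j
  · intro J hJ
    exact image_orderEmbOfFin_univ _ _
  · intro i hi
    simp only [mem_filter, Fintype.mem_piFinset] at hi
    exact (orderEmbOfFin_unique _ (fun j => mem_image_of_mem _ (mem_univ j)) hi.2).symm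
  · intro J hJ
    rw [kernelOn, dif_pos (mem_powersetCard.1 hJ).2]

/-- The `m`-subsets of `range n` that contain `k`. -/
def subsetsThrough (m n k : ℕ) : Finset (Finset ℕ) :=
  (powersetCard m (range n)).filter (k ∈ ·)

theorem mem_subsetsThrough {m n k : ℕ} {J : Finset ℕ} :
    J ∈ subsetsThrough m n k ↔ J ⊆ range n ∧ #J = m ∧ k ∈ J := by
  simp [subsetsThrough, mem_powersetCard, and_assoc]

theorem filter_notMem_powersetCard (m : ℕ) (s : Finset ℕ) (k : ℕ) :
    (powersetCard m s).filter (k ∉ ·) = powersetCard m (s.erase k) := by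
  ext J
  simp only [mem_filter, mem_powersetCard, subset_erase]
  tauto

theorem card_filter_mem_powersetCard {m : ℕ} (hm : 1 ≤ m) {s : Finset ℕ} {k : ℕ} (hk : k ∈ s) :
    #((powersetCard m s).filter (k ∈ ·)) = (#s - 1).choose (m - 1) := by
  have h1 := card_filter_add_card_filter_not (s := powersetCard m s) (k ∈ ·)
  rw [filter_notMem_powersetCard, card_powersetCard, card_powersetCard, card_erase_of_mem hk] at h1
  obtain ⟨a, ha⟩ : ∃ a, #s = a + 1 := ⟨#s - 1, by have := card_pos.2 ⟨k, hk⟩; omega⟩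
  obtain ⟨b, rfl⟩ : ∃ b, m = b + 1 := ⟨m - 1, by omega⟩
  rw [ha, Nat.choose_succ_succ] at h1
  rw [ha]
  simp only [Nat.add_sub_cancel, Nat.succ_eq_add_one] at h1 ⊢
  omega

theorem card_subsetsThrough {m n k : ℕ} (hm : 1 ≤ m) (hk : k < n) :
    #(subsetsThrough m n k) = (n - 1).choose (m - 1) := by
  rw [subsetsThrough, card_filter_mem_powersetCard hm (mem_range.2 hk), card_range]

/-- A fraction (m-1)/(n-1) of the sets through k also contains l. The product form avoids division
and covers m = 1, where no such set exists. The count comes from the complement, the C(n-2, m-1)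
sets that avoid l. -/
theorem card_filter_mem_subsetsThrough {m n k l : ℕ} (hm : 1 ≤ m) (hmn : m ≤ n) (hk : k < n)
    (hl : l < n) (hkl : k ≠ l) :
    (n - 1) * #((subsetsThrough m n k).filter (l ∈ ·)) = (m - 1) * (n - 1).choose (m - 1) := by
  have h1 := card_filter_add_card_filter_not (s := subsetsThrough m n k) (l ∈ ·)
  have h2 : (subsetsThrough m n k).filter (l ∉ ·) =
      (powersetCard m ((range n).erase l)).filter (k ∈ ·) := by
    rw [subsetsThrough, filter_comm, filter_notMem_powersetCard]
  rw [h2, card_filter_mem_powersetCard hm (mem_erase.2 ⟨hkl, mem_range.2 hk⟩),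
    card_erase_of_mem (mem_range.2 hl), card_range, card_subsetsThrough hm hk] at h1
  obtain ⟨a, rfl⟩ : ∃ a, n = a + 2 := ⟨n - 2, by omega⟩
  obtain ⟨b, rfl⟩ : ∃ b, m = b + 1 := ⟨m - 1, by omega⟩
  have h3 := Nat.choose_mul_succ_eq a b
  simp only [Nat.add_sub_cancel, show a + 2 - 1 = a + 1 by omega,
    show a + 1 - 1 = a by omega] at h1 h3 ⊢
  have h4 : b ≤ a + 1 := by omega
  zify [h4] at h1 h3 ⊢
  linear_combination ((a : ℤ) + 1) * h1 - h3

/-- The average of the kernel over the `m`-subsets of the sample that contain the observation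
with index `k`. -/
noncomputable def averageThrough {m : ℕ} (h : (Fin m → ℝ) → ℝ) (n k : ℕ) (x : ℕ → ℝ) : ℝ :=
  ((n - 1).choose (m - 1) : ℝ)⁻¹ * ∑ J ∈ subsetsThrough m n k, kernelOn h J x

theorem sum_subsetsThrough {m : ℕ} (h : (Fin m → ℝ) → ℝ) (n : ℕ) (x : ℕ → ℝ) :
    ∑ k ∈ range n, ∑ J ∈ subsetsThrough m n k, kernelOn h J x = m * kernelSum h (range n) x := by
  simp_rw [subsetsThrough, sum_filter]
  rw [sum_comm, kernelSum_eq_sum_powersetCard, mul_sum]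
  refine sum_congr rfl fun J hJ => ?_
  obtain ⟨h1, h2⟩ := mem_powersetCard.1 hJ
  rw [← sum_filter, sum_const, nsmul_eq_mul, filter_mem_eq_inter, inter_eq_right.2 h1, h2]

theorem cast_choose_pred {m n : ℕ} (hm : 1 ≤ m) (hn : 1 ≤ n) :
    (n : ℝ) * ((n - 1).choose (m - 1) : ℝ) = m * (n.choose m : ℝ) := by
  obtain ⟨a, rfl⟩ : ∃ a, n = a + 1 := ⟨n - 1, by omega⟩
  obtain ⟨b, rfl⟩ : ∃ b, m = b + 1 := ⟨m - 1, by omega⟩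
  have := Nat.add_one_mul_choose_eq a b
  simp only [Nat.add_sub_cancel]
  rw [mul_comm ((b + 1 : ℕ) : ℝ)]
  exact_mod_cast this

/-- Double counting: every m-set is counted once for each of its m elements. -/
theorem uStat_eq_average {m n : ℕ} (hm : 1 ≤ m) (hn : m ≤ n) (h : (Fin m → ℝ) → ℝ) (x : ℕ → ℝ) :
    (n : ℝ) * uStat h n x = ∑ k ∈ range n, averageThrough h n k x := by
  simp_rw [averageThrough, ← mul_sum, sum_subsetsThrough, uStat]
  have h1 := cast_choose_pred hm (hm.trans hn)
  have h2 : (0 : ℝ) < n.choose m := by exact_mod_cast Nat.choose_pos hn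
  have h3 : (0 : ℝ) < (n - 1).choose (m - 1) := by exact_mod_cast Nat.choose_pos (by omega)
  field_simp
  linear_combination kernelSum h (range n) x * h1

/-- The m-sets split into those through k and those avoiding k, in proportions m/n and (n-m)/n, so
U_n is the corresponding convex combination of T_k and the jackknifed value. -/
theorem jackknife_sub_uStat {m n k : ℕ} (hm : 1 ≤ m) (hn : m < n) (hk : k < n)
    (h : (Fin m → ℝ) → ℝ) (x : ℕ → ℝ) :
    jackknife h n k x - uStat h n x =
      (m : ℝ) / (n - m) * (uStat h n x - averageThrough h n k x) := by
  have hS : kernelSum h ((range n).erase k) x =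
      kernelSum h (range n) x - ∑ J ∈ subsetsThrough m n k, kernelOn h J x := by
    rw [kernelSum_eq_sum_powersetCard, kernelSum_eq_sum_powersetCard, subsetsThrough,
      ← filter_notMem_powersetCard, eq_sub_iff_add_eq, add_comm, sum_filter_add_sum_filter_not]
  have h1 := cast_choose_pred hm (hm.trans hn.le)
  have h2 : (0 : ℝ) < n.choose m := by exact_mod_cast Nat.choose_pos hn.le
  have h3 : (0 : ℝ) < (n - 1).choose (m - 1) := by exact_mod_cast Nat.choose_pos (by omega)
  have h4 : (0 : ℝ) < (n - 1).choose m := by exact_mod_cast Nat.choose_pos (by omega)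
  have h5 : (n.choose m : ℝ) = (n - 1).choose (m - 1) + (n - 1).choose m := by
    obtain ⟨a, rfl⟩ : ∃ a, n = a + 1 := ⟨n - 1, by omega⟩
    obtain ⟨b, rfl⟩ : ∃ b, m = b + 1 := ⟨m - 1, by omega⟩
    simp [Nat.choose_succ_succ]
  have h6 : (0 : ℝ) < (n : ℝ) - m := sub_pos.2 (by exact_mod_cast hn)
  have hm0 : (0 : ℝ) < m := by exact_mod_cast hm
  have hn0 : (0 : ℝ) < n := by linarith
  rw [jackknife, uStat, averageThrough, hS]
  set S := kernelSum h (range n) x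
  set Q := ∑ J ∈ subsetsThrough m n k, kernelOn h J x
  have e1 : ((n - 1).choose (m - 1) : ℝ) = m * n.choose m / n := by
    field_simp; linear_combination h1
  have e2 : ((n - 1).choose m : ℝ) = (n - m) * n.choose m / n := by
    field_simp; linear_combination (-(n : ℝ)) * h5 - h1
  rw [e1, e2]
  field_simp
  ring

/-! ### Characteristic functions and the lower bound on the norming constants. -/

theorem norm_charFun_sq_eq_integral_cos (μ : Measure ℝ) [IsProbabilityMeasure μ] (t : ℝ) :
    ‖charFun μ t‖ ^ 2 = ∫ p, Real.cos (t * (p.1 - p.2)) ∂(μ.prod μ) := by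
  have h1 : ((‖charFun μ t‖ ^ 2 : ℝ) : ℂ) =
      ∫ p : ℝ × ℝ, Complex.exp (((t * (p.1 - p.2) : ℝ) : ℂ) * Complex.I) ∂(μ.prod μ) := by
    push_cast
    rw [← Complex.mul_conj', ← charFun_neg, charFun_apply_real, charFun_apply_real,
      ← integral_prod_mul]
    congr 1 with p
    rw [← Complex.exp_add]
    congr 1
    push_cast
    ring
  have h2 : Integrable
      (fun p : ℝ × ℝ => Complex.exp (((t * (p.1 - p.2) : ℝ) : ℂ) * Complex.I)) (μ.prod μ) := by
    refine Integrable.of_bound (C := 1) ?_ (Eventually.of_forall fun p => ?_)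
    · exact (by fun_prop : Measurable _).aestronglyMeasurable
    · rw [Complex.norm_exp_ofReal_mul_I]
  have h3 := congrArg Complex.re h1
  rw [Complex.ofReal_re, ← RCLike.re_eq_complex_re, ← integral_re h2] at h3
  rw [h3]
  congr 1 with p
  rw [RCLike.re_eq_complex_re, Complex.exp_ofReal_mul_I_re]

/-- No moment is assumed. The symmetrised variable p.1 - p.2 is either a.s. zero or has absolute
value in some [1/M, M] with positive probability η; on that event the cosine falls quadratically
below 1. -/
theorem norm_charFun_eq_one_or_sq_le (μ : Measure ℝ) [IsProbabilityMeasure μ] :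
    (∀ t, ‖charFun μ t‖ = 1) ∨
      ∃ c > 0, ∃ δ > 0, ∀ t : ℝ, |t| ≤ δ → ‖charFun μ t‖ ^ 2 ≤ 1 - c * t ^ 2 := by
  by_cases h0 : ∀ᵐ p : ℝ × ℝ ∂(μ.prod μ), p.1 - p.2 = 0
  · left
    intro t
    have h1 : ‖charFun μ t‖ ^ 2 = 1 := by
      rw [norm_charFun_sq_eq_integral_cos, integral_congr_ae (g := fun _ => (1 : ℝ))]
      · simp
      · filter_upwards [h0] with p hp
        simp [hp]
    exact (pow_eq_one_iff_of_nonneg (norm_nonneg _) two_ne_zero).1 h1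
  right
  let S : ℕ → Set (ℝ × ℝ) := fun N =>
    {p | ((N : ℝ) + 1)⁻¹ ≤ |p.1 - p.2| ∧ |p.1 - p.2| ≤ (N : ℝ) + 1}
  have hSm (N : ℕ) : MeasurableSet (S N) :=
    (measurableSet_le measurable_const (by fun_prop :
      Measurable fun p : ℝ × ℝ => |p.1 - p.2|)).inter
      (measurableSet_le (by fun_prop :
        Measurable fun p : ℝ × ℝ => |p.1 - p.2|) measurable_const)
  obtain ⟨N, hN⟩ : ∃ N, (μ.prod μ) (S N) ≠ 0 := by
    by_contra! hcon
    apply h0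
    rw [ae_iff]
    refine measure_mono_null (fun p hp => ?_) (measure_iUnion_null hcon)
    have hp' : 0 < |p.1 - p.2| := abs_pos.2 hp
    obtain ⟨a, ha⟩ := exists_nat_ge (|p.1 - p.2|)
    obtain ⟨b, hb⟩ := exists_nat_ge (|p.1 - p.2|⁻¹)
    refine Set.mem_iUnion.2 ⟨a + b, ?_, ?_⟩
    · refine inv_le_of_inv_le₀ hp' (hb.trans ?_)
      push_cast
      linarith [(Nat.cast_nonneg a : (0 : ℝ) ≤ a)]
    · refine ha.trans ?_
      push_cast
      linarith [(Nat.cast_nonneg b : (0 : ℝ) ≤ b)]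
  set M : ℝ := (N : ℝ) + 1
  have hM : 0 < M := by positivity
  set η : ℝ := (μ.prod μ).real (S N)
  have hη : 0 < η := ENNReal.toReal_pos hN (measure_ne_top _ _)
  -- With δ = π/M the argument of the cosine stays in [-π, π] on `S N`, where cos x ≤ 1 - (2/π^2)
  -- x^2.
  refine ⟨2 / Real.pi ^ 2 * M⁻¹ ^ 2 * η, by positivity, Real.pi / M, by positivity,
    fun t ht => ?_⟩
  rw [norm_charFun_sq_eq_integral_cos]
  have hint : Integrable (fun p : ℝ × ℝ =>
      (1 : ℝ) - (S N).indicator (fun _ => 2 / Real.pi ^ 2 * M⁻¹ ^ 2 * t ^ 2) p) (μ.prod μ) :=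
    (integrable_const _).sub ((integrable_const _).indicator (hSm N))
  calc ∫ p, Real.cos (t * (p.1 - p.2)) ∂(μ.prod μ)
      ≤ ∫ p, ((1 : ℝ) - (S N).indicator (fun _ => 2 / Real.pi ^ 2 * M⁻¹ ^ 2 * t ^ 2) p)
          ∂(μ.prod μ) := by
        refine integral_mono (Integrable.of_bound (C := 1) ?_ ?_) hint fun p => ?_
        · exact (by fun_prop : Measurable _).aestronglyMeasurable
        · exact Eventually.of_forall fun p => Real.abs_cos_le_one _
        · by_cases hp : p ∈ S N
          · simp only [Set.indicator_of_mem hp]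
            have hle : |t * (p.1 - p.2)| ≤ Real.pi := by
              rw [abs_mul]
              calc |t| * |p.1 - p.2| ≤ Real.pi / M * M := by
                    gcongr
                    exact hp.2
                _ = Real.pi := by field_simp
            refine (Real.cos_le_one_sub_mul_cos_sq hle).trans ?_
            have : M⁻¹ ^ 2 ≤ (p.1 - p.2) ^ 2 := by
              rw [← sq_abs (p.1 - p.2)]
              gcongr
              exact hp.1
            rw [mul_pow, mul_assoc, mul_comm (M⁻¹ ^ 2)]
            gcongr
          · simp only [Set.indicator_of_notMem hp, sub_zero]
            exact Real.cos_le_one _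
    _ = 1 - 2 / Real.pi ^ 2 * M⁻¹ ^ 2 * η * t ^ 2 := by
        rw [integral_sub (integrable_const _) ((integrable_const _).indicator (hSm N)),
          integral_indicator_const _ (hSm N)]
        simp [η]
        ring

/-- Centring contributes only a phase, so taking the modulus removes the unknown constants A_n. -/
theorem norm_charFun_normalized_sum {Ω : Type*} [MeasurableSpace Ω] {P : Measure Ω}
    [IsProbabilityMeasure P] {Y : ℕ → Ω → ℝ} (hindep : iIndepFun Y P)
    (hident : ∀ i, IdentDistrib (Y i) (Y 0) P P) (n : ℕ) (a b u : ℝ) :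
    ‖charFun (P.map (fun ω => (∑ i ∈ range n, Y i ω - a) / b)) u‖ =
      ‖charFun (P.map (Y 0)) (u / b)‖ ^ n := by
  have mY i := (hident i).aemeasurable_fst
  have hS : AEMeasurable (fun ω => ∑ i ∈ range n, Y i ω) P :=
    Finset.aemeasurable_fun_sum _ fun _ _ => mY _
  have h1 : P.map (fun ω => (∑ i ∈ range n, Y i ω - a) / b) =
      (P.map (fun ω => b⁻¹ * ∑ i ∈ range n, Y i ω)).map (· + (-a / b)) := by
    rw [AEMeasurable.map_map_of_aemeasurable (by fun_prop) (hS.const_mul _)]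
    congr 1 with ω
    simp only [Function.comp_apply]
    ring
  have h2 : charFun (P.map (fun ω => b⁻¹ * ∑ i ∈ range n, Y i ω)) u =
      charFun (P.map (Y 0)) (b⁻¹ * u) ^ n := by
    rw [charFun_map_mul_comp hS,
      (hindep.restrict _).charFun_map_fun_finsetSum_eq_prod (fun _ _ => mY _)]
    simp [fun i => (hident i).map_eq]
  rw [h1, charFun_map_add_const, norm_mul, h2, norm_pow, Complex.norm_exp_ofReal_mul_I, mul_one,
    inv_mul_eq_div]

/-- The normalising constants of a sequence attracted to the normal law are at least of
order `√n`. -/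
theorem NormalAttraction.exists_le {Ω : Type*} [MeasurableSpace Ω] {P : Measure Ω}
    [IsProbabilityMeasure P] {Y : ℕ → Ω → ℝ} (hindep : iIndepFun Y P)
    (hident : ∀ i, IdentDistrib (Y i) (Y 0) P P) {A ℓ : ℕ → ℝ}
    (hN : NormalAttraction P Y A (fun n => Real.sqrt n * ℓ n)) :
    ∃ c > 0, ∀ᶠ n in atTop, c ≤ ℓ n := by
  obtain ⟨hpos, hd⟩ := hN
  have := Measure.isProbabilityMeasure_map (hident 0).aemeasurable_fst
  have hlim := hd.tendsto
  set Z : ℕ → Ω → ℝ := fun n ω => (∑ i ∈ range n, Y i ω - A n) / (Real.sqrt n * ℓ n) with hZ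
  have hZm : ∀ n, AEMeasurable (Z n) P := hd.forall_aemeasurable
  have hchar : Tendsto (fun n => charFun (P.map (Z n)) 1) atTop
      (𝓝 (charFun (gaussianReal 0 1) 1)) := by
    have := (ProbabilityMeasure.tendsto_iff_tendsto_charFun.1 hlim) 1
    simpa using this
  rcases norm_charFun_eq_one_or_sq_le (P.map (Y 0)) with h1 | ⟨c, hc, δ, hδ, hle⟩
  -- In the degenerate case the moduli are all 1, while the Gaussian limit at 1 has modulus
  -- exp(-1/2).
  · exfalso
    have h2 := hchar.norm
    simp only [hZ, norm_charFun_normalized_sum hindep hident, h1, one_pow] at h2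
    have h3 := tendsto_nhds_unique tendsto_const_nhds h2
    rw [charFun_gaussianReal, Complex.norm_exp] at h3
    norm_num at h3
    exact absurd h3.symm (by simp)
  have hgi : Integrable (fun z : ℝ => |z|) (gaussianReal 0 1) := by
    have := (memLp_id_gaussianReal (μ := 0) (v := 1) 1)
    have hid : Integrable (id : ℝ → ℝ) (gaussianReal 0 1) :=
      memLp_one_iff_integrable.1 (by simpa using this)
    exact hid.abs
  -- The factor 8 makes the Gaussian mean of min(1, |z|/K) less than 1/8. Since |exp(iuz) - 1| ≤ 2
  -- min(1, |z|/K) for |u| ≤ 2/K, the characteristic function of `Z n` is then within 1/4 of 1 for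
  -- large n. The minimum gives a bounded continuous test function, as weak convergence requires.
  set K : ℝ := 8 * ((∫ z, |z| ∂(gaussianReal 0 1)) + 1)
  have hI : 0 ≤ ∫ z, |z| ∂(gaussianReal 0 1) := integral_nonneg fun _ => abs_nonneg _
  have hK : 0 < K := by positivity
  let f : BoundedContinuousFunction ℝ ℝ :=
    BoundedContinuousFunction.ofNormedAddCommGroup (fun z : ℝ => min 1 (|z| / K)) (by fun_prop) 1
      fun z => by
        rw [Real.norm_of_nonneg (by positivity)]
        exact min_le_left _ _
  have hf : ∀ z, f z = min 1 (|z| / K) := fun _ => rfl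
  have hfZ : Tendsto (fun n => ∫ ω, min 1 (|Z n ω| / K) ∂P) atTop
      (𝓝 (∫ z, min 1 (|z| / K) ∂(gaussianReal 0 1))) := by
    have := (ProbabilityMeasure.tendsto_iff_forall_integral_tendsto.1 hlim) f
    simp only [ProbabilityMeasure.coe_mk, Measure.map_id, hf] at this
    refine this.congr fun n => ?_
    rw [integral_map (hZm n)]
    exact (by fun_prop : Measurable _).aestronglyMeasurable
  have hfG : ∫ z, min 1 (|z| / K) ∂(gaussianReal 0 1) < 1 / 8 := by
    calc ∫ z, min 1 (|z| / K) ∂(gaussianReal 0 1)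
        ≤ ∫ z, |z| / K ∂(gaussianReal 0 1) :=
          integral_mono (f.integrable _) (hgi.div_const _) fun z => min_le_right _ _
      _ = (∫ z, |z| ∂(gaussianReal 0 1)) / K := integral_div _ _
      _ < 1 / 8 := by
          rw [div_lt_iff₀ hK]
          simp only [K]
          linarith
  have hlow : ∀ᶠ n in atTop, ∀ u : ℝ, |u| ≤ 2 / K → 3 / 4 ≤ ‖charFun (P.map (Z n)) u‖ := by
    filter_upwards [hfZ.eventually_lt_const hfG] with n hn u hu
    have := Measure.isProbabilityMeasure_map (hZm n)
    have hmi : Integrable (fun ω => min 1 (|Z n ω| / K)) P := by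
      refine Integrable.of_bound (C := 1) ?_ (Eventually.of_forall fun ω => ?_)
      · exact ((by fun_prop : Measurable fun z : ℝ => min 1 (|z| / K)).comp_aemeasurable
          (hZm n)).aestronglyMeasurable
      · rw [Real.norm_of_nonneg (by positivity)]
        exact min_le_left _ _
    have hei : Integrable (fun ω => Complex.exp ((u : ℂ) * (Z n ω) * Complex.I)) P := by
      refine Integrable.of_bound (C := 1) ?_ (Eventually.of_forall fun ω => ?_)
      · exact ((by fun_prop : Measurable fun z : ℝ =>
          Complex.exp ((u : ℂ) * z * Complex.I)).comp_aemeasurable (hZm n)).aestronglyMeasurable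
      · rw [← Complex.ofReal_mul, Complex.norm_exp_ofReal_mul_I]
    have h1 : ‖charFun (P.map (Z n)) u - 1‖ ≤ 2 * ∫ ω, min 1 (|Z n ω| / K) ∂P := by
      rw [charFun_apply_real, integral_map (hZm n)
        (by fun_prop : Measurable _).aestronglyMeasurable, ← integral_const_mul]
      calc ‖∫ ω, Complex.exp (u * (Z n ω) * Complex.I) ∂P - 1‖
          = ‖∫ ω, (Complex.exp (u * (Z n ω) * Complex.I) - 1) ∂P‖ := by
            rw [integral_sub hei (integrable_const _)]
            simp
        _ ≤ ∫ ω, 2 * min 1 (|Z n ω| / K) ∂P := by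
            refine norm_integral_le_of_norm_le (hmi.const_mul 2)
              (Eventually.of_forall fun ω => ?_)
            rw [mul_min_of_nonneg _ _ (by norm_num : (0 : ℝ) ≤ 2)]
            refine le_min ?_ ?_
            · refine (norm_sub_le _ _).trans ?_
              rw [← Complex.ofReal_mul, Complex.norm_exp_ofReal_mul_I]
              norm_num
            · have := Real.norm_exp_I_mul_ofReal_sub_one_le (x := u * Z n ω)
              rw [mul_comm Complex.I, Complex.ofReal_mul] at this
              refine this.trans ?_
              rw [Real.norm_eq_abs, abs_mul]
              calc |u| * |Z n ω| ≤ 2 / K * |Z n ω| := by gcongr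
                _ = 2 * (|Z n ω| / K) := by ring
    have h2 : ‖(1 : ℂ)‖ ≤ ‖charFun (P.map (Z n)) u‖ + ‖charFun (P.map (Z n)) u - 1‖ := by
      calc ‖(1 : ℂ)‖ = ‖charFun (P.map (Z n)) u - (charFun (P.map (Z n)) u - 1)‖ := by simp
        _ ≤ _ := norm_sub_le _ _
    rw [norm_one] at h2
    linarith
  -- Chosen so that c (t/√n)^2 = 2/n, which makes the n-th power below comparable to exp(-2).
  set t : ℝ := Real.sqrt (2 / c)
  have ht : 0 < t := Real.sqrt_pos.2 (by positivity)
  have ht2 : c * t ^ 2 = 2 := by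
    rw [Real.sq_sqrt (by positivity)]
    field_simp
  have hsmall : ∀ᶠ n : ℕ in atTop, t / Real.sqrt n ≤ δ := by
    have : Tendsto (fun n : ℕ => t / Real.sqrt n) atTop (𝓝 0) :=
      tendsto_const_nhds.div_atTop
        (Real.tendsto_sqrt_atTop.comp tendsto_natCast_atTop_atTop)
    exact (this.eventually_lt_const hδ).mono fun _ => le_of_lt
  refine ⟨2 / K / t, by positivity, ?_⟩
  filter_upwards [hlow, hsmall, eventually_ge_atTop 1] with n h1 h2 hn
  -- If ℓ(n) were smaller, u = t ℓ(n) would satisfy |u| ≤ 2/K, so the modulus at u would be at least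
  -- 3/4. But it equals the n-th power of the modulus at t/√n, whose square is at most exp(-2) < 1/2
  -- < 9/16.
  by_contra! hcon
  have hs : 0 < Real.sqrt n := Real.sqrt_pos.2 (by exact_mod_cast hn)
  have hl : 0 < ℓ n := (mul_pos_iff_of_pos_left hs).1 (hpos n hn)
  have h3 := h1 (t * ℓ n) (by
    rw [abs_of_pos (by positivity), mul_comm]
    exact ((lt_div_iff₀ ht).1 hcon).le)
  rw [hZ, norm_charFun_normalized_sum hindep hident,
    show t * ℓ n / (Real.sqrt n * ℓ n) = t / Real.sqrt n by field_simp] at h3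
  have h4 := hle (t / Real.sqrt n) (by rwa [abs_of_pos (by positivity)])
  have hn0 : (0 : ℝ) < n := by exact_mod_cast hn
  have h5 : c * (t / Real.sqrt n) ^ 2 = 2 / n := by
    rw [div_pow, Real.sq_sqrt hn0.le, ← mul_div_assoc, ht2]
  rw [h5] at h4
  set r := ‖charFun (P.map (Y 0)) (t / Real.sqrt n)‖
  have h6 : (r ^ n) ^ 2 ≤ Real.exp (-2) := by
    calc (r ^ n) ^ 2 = (r ^ 2) ^ n := by ring
      _ ≤ (Real.exp (-(2 / n))) ^ n := by
          gcongr
          linarith [Real.add_one_le_exp (-(2 / n : ℝ))]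
      _ = Real.exp (-2) := by
          rw [← Real.exp_nat_mul]
          congr 1
          field_simp
  have h7 : Real.exp (-2) < 1 / 2 := by
    rw [Real.exp_neg]
    have := Real.add_one_le_exp (2 : ℝ)
    rw [inv_lt_comm₀ (Real.exp_pos _) (by norm_num)]
    linarith
  nlinarith

/-! ### Conditional mean given the first argument, under the product law. -/

/-- The tuple `y` with its first entry replaced by `x`. -/
def replaceFirst {m : ℕ} (x : ℝ) (y : Fin m → ℝ) : Fin m → ℝ :=
  fun j => if (j : ℕ) = 0 then x else y j

theorem measurable_replaceFirst {m : ℕ} :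
    Measurable (fun p : ℝ × (Fin m → ℝ) => replaceFirst p.1 p.2) := by
  refine measurable_pi_lambda _ fun j => ?_
  unfold replaceFirst
  split_ifs <;> fun_prop

theorem measurable_replaceFirst_right {m : ℕ} (x : ℝ) :
    Measurable (replaceFirst (m := m) x) :=
  measurable_replaceFirst.comp (measurable_const.prodMk measurable_id)

/-- The conditional mean of the kernel given its first argument. -/
noncomputable def condMean {m : ℕ} (f : (Fin m → ℝ) → ℝ) (F : Measure ℝ) (x : ℝ) : ℝ :=
  ∫ y, f (replaceFirst x y) ∂(Measure.pi fun _ : Fin m => F)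

theorem abs_condMean_le {m : ℕ} {F : Measure ℝ} (f : (Fin m → ℝ) → ℝ) (x : ℝ) :
    |condMean f F x| ≤ condMean (fun y => |f y|) F x :=
  norm_integral_le_integral_norm fun y => f (replaceFirst x y)

section Law

variable {m : ℕ} {F : Measure ℝ} [IsProbabilityMeasure F]

/-- The entry y 0 is discarded and an independent variable of the same law takes its place. This
turns integrals over F^m into iterated integrals with the first argument outside. -/
theorem measurePreserving_replaceFirst (hm : 1 ≤ m) (F : Measure ℝ) [IsProbabilityMeasure F] :
    MeasurePreserving (fun p : ℝ × (Fin m → ℝ) => replaceFirst p.1 p.2)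
      (F.prod (Measure.pi fun _ => F)) (Measure.pi fun _ => F) := by
  refine ⟨measurable_replaceFirst, (Measure.pi_eq fun s hs => ?_).symm⟩
  rw [Measure.map_apply measurable_replaceFirst (MeasurableSet.univ_pi hs)]
  obtain ⟨b, rfl⟩ : ∃ b, m = b + 1 := ⟨m - 1, by omega⟩
  have h1 : (fun p : ℝ × (Fin (b + 1) → ℝ) => replaceFirst p.1 p.2) ⁻¹' Set.univ.pi s =
      s 0 ×ˢ Set.univ.pi (fun j : Fin (b + 1) => if (j : ℕ) = 0 then Set.univ else s j) := by
    ext p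
    simp only [Set.mem_preimage, Set.mem_univ_pi, Set.mem_prod, replaceFirst, Fin.forall_fin_succ]
    simp
  rw [h1, Measure.prod_prod, Measure.pi_pi, Fin.prod_univ_succ, Fin.prod_univ_succ]
  simp

theorem measurable_condMean {f : (Fin m → ℝ) → ℝ} (hf : Measurable f) :
    Measurable (condMean f F) := by
  have : StronglyMeasurable (fun p : ℝ × (Fin m → ℝ) => f (replaceFirst p.1 p.2)) :=
    (hf.comp measurable_replaceFirst).stronglyMeasurable
  exact this.integral_prod_right'.measurable

theorem abs_condMean_le_of_bound {f : (Fin m → ℝ) → ℝ} {M : ℝ} (hM : ∀ y, |f y| ≤ M) (x : ℝ) :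
    |condMean f F x| ≤ M := by
  have := norm_integral_le_of_norm_le_const (μ := Measure.pi fun _ : Fin m => F)
    (f := fun y => f (replaceFirst x y)) (C := M) (Eventually.of_forall fun y => hM _)
  simpa [condMean] using this

theorem integrable_comp_replaceFirst (hm : 1 ≤ m) {f : (Fin m → ℝ) → ℝ}
    (hf : Integrable f (Measure.pi fun _ => F)) :
    Integrable (fun p : ℝ × (Fin m → ℝ) => f (replaceFirst p.1 p.2))
      (F.prod (Measure.pi fun _ => F)) :=
  (measurePreserving_replaceFirst hm F).integrable_comp_of_integrable hf

theorem ae_integrable_section (hm : 1 ≤ m) {f : (Fin m → ℝ) → ℝ}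
    (hf : Integrable f (Measure.pi fun _ => F)) :
    ∀ᵐ x ∂F, Integrable (fun y => f (replaceFirst x y)) (Measure.pi fun _ : Fin m => F) :=
  (integrable_comp_replaceFirst hm hf).prod_right_ae

theorem integrable_condMean (hm : 1 ≤ m) {f : (Fin m → ℝ) → ℝ}
    (hf : Integrable f (Measure.pi fun _ => F)) : Integrable (condMean f F) F :=
  (integrable_comp_replaceFirst hm hf).integral_prod_left

theorem integral_condMean (hm : 1 ≤ m) {f : (Fin m → ℝ) → ℝ}
    (hf : Integrable f (Measure.pi fun _ => F)) :
    ∫ x, condMean f F x ∂F = ∫ y, f y ∂(Measure.pi fun _ => F) := by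
  have hmp := measurePreserving_replaceFirst hm F
  unfold condMean
  rw [← integral_prod _ (integrable_comp_replaceFirst hm hf)]
  conv_rhs => rw [← hmp.map_eq]
  rw [integral_map hmp.aemeasurable]
  rw [hmp.map_eq]
  exact hf.aestronglyMeasurable

theorem integral_abs_condMean_le (hm : 1 ≤ m) {f : (Fin m → ℝ) → ℝ}
    (hf : Integrable f (Measure.pi fun _ => F)) :
    ∫ x, |condMean f F x| ∂F ≤ ∫ y, |f y| ∂(Measure.pi fun _ => F) := by
  rw [← integral_condMean hm hf.abs]
  exact integral_mono (integrable_condMean hm hf).abs (integrable_condMean hm hf.abs)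
    (abs_condMean_le f)

theorem integrable_of_abs_le {α : Type*} [MeasurableSpace α] {μ : Measure α} [IsFiniteMeasure μ]
    {f : α → ℝ} (hf : Measurable f) {M : ℝ} (hM : ∀ y, |f y| ≤ M) : Integrable f μ :=
  Integrable.of_bound hf.aestronglyMeasurable M (Eventually.of_forall hM)

theorem sq_integral_le_integral_sq {α : Type*} [MeasurableSpace α] {μ : Measure α}
    [IsProbabilityMeasure μ] {f : α → ℝ} (hf : Measurable f) {M : ℝ} (hM : ∀ y, |f y| ≤ M) :
    (∫ y, f y ∂μ) ^ 2 ≤ ∫ y, f y ^ 2 ∂μ := by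
  have h := variance_nonneg f μ
  rw [variance_eq_sub (MemLp.of_bound hf.aestronglyMeasurable M (Eventually.of_forall hM))] at h
  simpa using h

theorem abs_sq_le_of_abs_le {a M : ℝ} (h : |a| ≤ M) : |a ^ 2| ≤ M ^ 2 := by
  rw [abs_pow]
  gcongr

theorem integral_condMean_sq_le (hm : 1 ≤ m) {f : (Fin m → ℝ) → ℝ} (hf : Measurable f)
    {M : ℝ} (hM : ∀ y, |f y| ≤ M) :
    ∫ x, condMean f F x ^ 2 ∂F ≤ ∫ y, f y ^ 2 ∂(Measure.pi fun _ => F) := by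
  have hi : Integrable (fun y => f y ^ 2) (Measure.pi fun _ : Fin m => F) :=
    integrable_of_abs_le (hf.pow_const 2) fun y => abs_sq_le_of_abs_le (hM y)
  rw [← integral_condMean hm hi]
  refine integral_mono (integrable_of_abs_le ((measurable_condMean hf).pow_const 2)
    fun x => abs_sq_le_of_abs_le (abs_condMean_le_of_bound hM x)) (integrable_condMean hm hi)
    fun x => ?_
  exact sq_integral_le_integral_sq (hf.comp (measurable_replaceFirst_right _))
    fun y => hM _

end Law

/-! ### Transfer between sample and law, and orthogonality of centred kernels. -/

theorem integral_comp_eq {Ω : Type*} [MeasurableSpace Ω] {P : Measure Ω}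
    {X : ℕ → Ω → ℝ} (hX : ∀ i, Measurable (X i))
    (hident : ∀ i, IdentDistrib (X i) (X 0) P P) (k : ℕ) {g : ℝ → ℝ} (hg : Measurable g) :
    ∫ ω, g (X k ω) ∂P = ∫ x, g x ∂(P.map (X 0)) := by
  rw [← (hident k).map_eq, integral_map (hX k).aemeasurable hg.aestronglyMeasurable]

theorem integrable_comp_iff {Ω : Type*} [MeasurableSpace Ω] {P : Measure Ω}
    {X : ℕ → Ω → ℝ} (hX : ∀ i, Measurable (X i))
    (hident : ∀ i, IdentDistrib (X i) (X 0) P P) (k : ℕ) {g : ℝ → ℝ} (hg : Measurable g) :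
    Integrable (fun ω => g (X k ω)) P ↔ Integrable g (P.map (X 0)) := by
  rw [← (hident k).map_eq, integrable_map_measure hg.aestronglyMeasurable (hX k).aemeasurable]
  rfl

section Sample

variable {Ω : Type*} [MeasurableSpace Ω] {P : Measure Ω} [IsProbabilityMeasure P]
  {X : ℕ → Ω → ℝ} {m : ℕ}

theorem measurable_tuple (hX : ∀ i, Measurable (X i)) (i : Fin m → ℕ) :
    Measurable (fun ω j => X (i j) ω) :=
  measurable_pi_lambda _ fun j => hX (i j)

theorem map_tuple (hX : ∀ i, Measurable (X i)) (hindep : iIndepFun X P)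
    (hident : ∀ i, IdentDistrib (X i) (X 0) P P) {i : Fin m → ℕ} (hi : Function.Injective i) :
    P.map (fun ω j => X (i j) ω) = Measure.pi fun _ => P.map (X 0) := by
  rw [(iIndepFun_iff_map_fun_eq_pi_map fun j => (hX (i j)).aemeasurable).1 (hindep.precomp hi)]
  simp only [(hident _).map_eq]

theorem map_prod_tuple (hX : ∀ i, Measurable (X i)) (hindep : iIndepFun X P)
    (hident : ∀ i, IdentDistrib (X i) (X 0) P P) {i i' : Fin m → ℕ} (hi : Function.Injective i)
    (hi' : Function.Injective i') (hne : ∀ j j', i j ≠ i' j') :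
    P.map (fun ω => ((fun j => X (i j) ω), (fun j => X (i' j) ω))) =
      (Measure.pi fun _ : Fin m => P.map (X 0)).prod (Measure.pi fun _ : Fin m => P.map (X 0)) := by
  have hd : Disjoint (univ.image i) (univ.image i') := by
    rw [disjoint_left]
    rintro a ha ha'
    obtain ⟨j, -, rfl⟩ := mem_image.1 ha
    obtain ⟨j', -, hj'⟩ := mem_image.1 ha'
    exact hne j j' hj'.symm
  have h1 := (hindep.indepFun_finset _ _ hd hX).comp
    (φ := fun w (j : Fin m) => w ⟨i j, mem_image_of_mem _ (mem_univ j)⟩)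
    (ψ := fun w (j : Fin m) => w ⟨i' j, mem_image_of_mem _ (mem_univ j)⟩)
    (by fun_prop) (by fun_prop)
  have h2 := h1.map_prod_eq_prod_map_map ((by fun_prop : Measurable _).aemeasurable)
    ((by fun_prop : Measurable _).aemeasurable)
  refine h2.trans (congrArg₂ Measure.prod ?_ ?_)
  · exact map_tuple hX hindep hident hi
  · exact map_tuple hX hindep hident hi'

theorem integral_tuple (hX : ∀ i, Measurable (X i)) (hindep : iIndepFun X P)
    (hident : ∀ i, IdentDistrib (X i) (X 0) P P) {i : Fin m → ℕ} (hi : Function.Injective i)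
    {f : (Fin m → ℝ) → ℝ} (hf : Measurable f) :
    ∫ ω, f (fun j => X (i j) ω) ∂P = ∫ y, f y ∂(Measure.pi fun _ => P.map (X 0)) := by
  rw [← map_tuple hX hindep hident hi, integral_map (measurable_tuple hX i).aemeasurable
    hf.aestronglyMeasurable]

theorem integrable_tuple_iff (hX : ∀ i, Measurable (X i)) (hindep : iIndepFun X P)
    (hident : ∀ i, IdentDistrib (X i) (X 0) P P) {i : Fin m → ℕ} (hi : Function.Injective i)
    {f : (Fin m → ℝ) → ℝ} (hf : Measurable f) :
    Integrable (fun ω => f (fun j => X (i j) ω)) P ↔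
      Integrable f (Measure.pi fun _ => P.map (X 0)) := by
  rw [← map_tuple hX hindep hident hi, integrable_map_measure hf.aestronglyMeasurable
    (measurable_tuple hX i).aemeasurable]
  rfl

/-- Kernels at two tuples that share only their first index are uncorrelated once they are centred
at the conditional mean given the common observation. -/
theorem integral_centered_mul_centered_eq_zero (hX : ∀ i, Measurable (X i))
    (hindep : iIndepFun X P) (hident : ∀ i, IdentDistrib (X i) (X 0) P P) (hm : 1 ≤ m)
    {f : (Fin m → ℝ) → ℝ} (hf : Measurable f) {M : ℝ} (hM : ∀ y, |f y| ≤ M) {k : ℕ}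
    {i i' : Fin m → ℕ} (hi : Function.Injective i) (hi' : Function.Injective i')
    (hik : i ⟨0, hm⟩ = k) (hik' : i' ⟨0, hm⟩ = k) (hne : ∀ j j' : Fin m, (j' : ℕ) ≠ 0 → i j ≠ i' j') :
    ∫ ω, (f (fun j => X (i j) ω) - condMean f (P.map (X 0)) (X k ω)) *
      (f (fun j => X (i' j) ω) - condMean f (P.map (X 0)) (X k ω)) ∂P = 0 := by
  have := Measure.isProbabilityMeasure_map (hX 0).aemeasurable (μ := P)
  set F := P.map (X 0)
  -- A fresh index N replaces k in the second tuple. The tuples `i` and `r` are then disjoint, hence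
  -- independent, and the N-entry is overwritten by X_k through `replaceFirst`. Integrating over the
  -- second tuple first annihilates the second factor.
  obtain ⟨N, hN⟩ := Infinite.exists_notMem_finset (univ.image i ∪ univ.image i')
  simp only [mem_union, mem_image, mem_univ, true_and, not_or, not_exists] at hN
  let r : Fin m → ℕ := fun j => if (j : ℕ) = 0 then N else i' j
  have hr : Function.Injective r := by
    intro a b hab
    simp only [r] at hab
    split_ifs at hab with h1 h2 h2
    · exact Fin.ext (h1.trans h2.symm)
    · exact absurd hab.symm (hN.2 b)
    · exact absurd hab (hN.2 a)
    · exact hi' hab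
  have hir (j j') : i j ≠ r j' := by
    simp only [r]
    split_ifs with h1
    · exact hN.1 j
    · exact hne j j' h1
  have hrep (ω : Ω) : (fun j => X (i' j) ω) = replaceFirst (X k ω) (fun j => X (r j) ω) := by
    funext j
    simp only [replaceFirst, r]
    split_ifs with h1
    · rw [← hik', show j = ⟨0, hm⟩ from Fin.ext h1]
    · rfl
  have hc := measurable_condMean (F := F) hf
  let G : (Fin m → ℝ) × (Fin m → ℝ) → ℝ := fun p =>
    (f p.1 - condMean f F (p.1 ⟨0, hm⟩)) *
      (f (replaceFirst (p.1 ⟨0, hm⟩) p.2) - condMean f F (p.1 ⟨0, hm⟩))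
  have hrm : Measurable fun p : (Fin m → ℝ) × (Fin m → ℝ) => replaceFirst (p.1 ⟨0, hm⟩) p.2 :=
    measurable_replaceFirst.comp (f := fun p : (Fin m → ℝ) × (Fin m → ℝ) => (p.1 ⟨0, hm⟩, p.2))
      (by fun_prop)
  have hG : Measurable G :=
    ((hf.comp measurable_fst).sub (hc.comp (by fun_prop))).mul
      ((hf.comp hrm).sub (hc.comp (by fun_prop)))
  have hcb (a : ℝ) (y : Fin m → ℝ) : |f y - condMean f F a| ≤ M + M :=
    (abs_sub _ _).trans (add_le_add (hM _) (abs_condMean_le_of_bound hM _))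
  have hGb (p) : |G p| ≤ (M + M) * (M + M) := by
    rw [abs_mul]
    exact mul_le_mul (hcb _ _) (hcb _ _) (abs_nonneg _) ((abs_nonneg _).trans (hcb 0 0))
  have h1 : ∫ ω, G ((fun j => X (i j) ω), (fun j => X (r j) ω)) ∂P = 0 := by
    have hmap := map_prod_tuple hX hindep hident hi hr hir
    rw [← integral_map (φ := fun ω => ((fun j => X (i j) ω), (fun j => X (r j) ω))) (f := G)
      ((measurable_tuple hX i).prodMk (measurable_tuple hX r)).aemeasurable
      hG.aestronglyMeasurable, hmap, integral_prod _ (integrable_of_abs_le hG hGb)]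
    refine integral_eq_zero_of_ae (Eventually.of_forall fun w => ?_)
    have hint : Integrable (fun y => f (replaceFirst (w ⟨0, hm⟩) y))
        (Measure.pi fun _ : Fin m => F) :=
      integrable_of_abs_le (hf.comp (measurable_replaceFirst_right _)) fun y => hM _
    simp only [G, Pi.zero_apply]
    rw [integral_const_mul, integral_sub hint (integrable_const _)]
    simp [condMean]
  rw [← h1]
  refine integral_congr_ae (Eventually.of_forall fun ω => ?_)
  simp only [G, hik, ← hrep]

end Sample

/-! ### Second moment of the residual. -/

theorem exists_tuple_of_mem_subsetsThrough {m n k : ℕ} (hm : 1 ≤ m) {J : Finset ℕ}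
    (hJ : J ∈ subsetsThrough m n k) :
    ∃ i : Fin m → ℕ, Function.Injective i ∧ univ.image i = J ∧ i ⟨0, hm⟩ = k := by
  obtain ⟨-, hc, hk⟩ := mem_subsetsThrough.1 hJ
  have hk' : k ∈ univ.image (J.orderEmbOfFin hc) := by rwa [image_orderEmbOfFin_univ]
  obtain ⟨a, -, ha⟩ := mem_image.1 hk'
  -- Swapping positions 0 and a in the increasing enumeration brings k to the front.
  refine ⟨fun j => J.orderEmbOfFin hc (Equiv.swap ⟨0, hm⟩ a j),
    (J.orderEmbOfFin hc).injective.comp (Equiv.injective _), ?_, ?_⟩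
  · refine Eq.trans ?_ (image_orderEmbOfFin_univ J hc)
    ext x
    simp only [mem_image, mem_univ, true_and]
    exact ⟨fun ⟨j, hj⟩ => ⟨_, hj⟩, fun ⟨j, hj⟩ => ⟨Equiv.swap ⟨0, hm⟩ a j, by simpa using hj⟩⟩
  · simpa using ha

/-- The deviation of the average of the kernel over the sets through `k` from its conditional mean
given the observation with index `k`. -/
noncomputable def residual {m : ℕ} (f : (Fin m → ℝ) → ℝ) (F : Measure ℝ) (n k : ℕ) (x : ℕ → ℝ) :
    ℝ :=
  averageThrough f n k x - condMean f F (x k)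

section Sample

variable {Ω : Type*} [MeasurableSpace Ω] {P : Measure Ω} [IsProbabilityMeasure P]
  {X : ℕ → Ω → ℝ} {m : ℕ}

theorem measurable_kernelOn (hX : ∀ i, Measurable (X i)) {f : (Fin m → ℝ) → ℝ}
    (hf : Measurable f) (J : Finset ℕ) : Measurable fun ω => kernelOn f J (fun k => X k ω) := by
  unfold kernelOn
  split_ifs with hJ
  · exact hf.comp (measurable_tuple hX _)
  · exact measurable_const

theorem integral_kernelOn (hX : ∀ i, Measurable (X i)) (hindep : iIndepFun X P)
    (hident : ∀ i, IdentDistrib (X i) (X 0) P P) {f : (Fin m → ℝ) → ℝ} (hf : Measurable f)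
    {φ : ℝ → ℝ} (hφ : Measurable φ) {J : Finset ℕ} (hJ : #J = m) :
    ∫ ω, φ (kernelOn f J (fun k => X k ω)) ∂P =
      ∫ y, φ (f y) ∂(Measure.pi fun _ => P.map (X 0)) := by
  simp only [kernelOn, dif_pos hJ]
  exact integral_tuple hX hindep hident (J.orderEmbOfFin hJ).injective (hφ.comp hf)

theorem integrable_kernelOn (hX : ∀ i, Measurable (X i)) (hindep : iIndepFun X P)
    (hident : ∀ i, IdentDistrib (X i) (X 0) P P) {f : (Fin m → ℝ) → ℝ} (hf : Measurable f)
    (hfi : Integrable f (Measure.pi fun _ => P.map (X 0))) {J : Finset ℕ} (hJ : #J = m) :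
    Integrable (fun ω => kernelOn f J (fun k => X k ω)) P := by
  simp only [kernelOn, dif_pos hJ]
  exact (integrable_tuple_iff hX hindep hident (J.orderEmbOfFin hJ).injective hf).2 hfi

theorem abs_kernelOn_le {f : (Fin m → ℝ) → ℝ} {M : ℝ} (hM : ∀ y, |f y| ≤ M) (J : Finset ℕ)
    (x : ℕ → ℝ) : |kernelOn f J x| ≤ M := by
  unfold kernelOn
  split_ifs
  · exact hM _
  · simpa using (abs_nonneg _).trans (hM 0)

theorem integrable_residual (hX : ∀ i, Measurable (X i)) (hindep : iIndepFun X P)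
    (hident : ∀ i, IdentDistrib (X i) (X 0) P P) (hm : 1 ≤ m) {f : (Fin m → ℝ) → ℝ}
    (hf : Measurable f) (hfi : Integrable f (Measure.pi fun _ => P.map (X 0))) (n k : ℕ) :
    Integrable (fun ω => residual f (P.map (X 0)) n k (fun k => X k ω)) P := by
  have := Measure.isProbabilityMeasure_map (hX 0).aemeasurable (μ := P)
  refine Integrable.sub (Integrable.const_mul (integrable_finsetSum _ fun J hJ => ?_) _) ?_
  · exact integrable_kernelOn hX hindep hident hf hfi (mem_subsetsThrough.1 hJ).2.1
  · exact (integrable_comp_iff hX hident k (measurable_condMean hf)).2 (integrable_condMean hm hfi)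

theorem integral_abs_residual_le (hX : ∀ i, Measurable (X i)) (hindep : iIndepFun X P)
    (hident : ∀ i, IdentDistrib (X i) (X 0) P P) (hm : 1 ≤ m) {f : (Fin m → ℝ) → ℝ}
    (hf : Measurable f) (hfi : Integrable f (Measure.pi fun _ => P.map (X 0))) {n k : ℕ}
    (hmn : m ≤ n) (hk : k < n) :
    ∫ ω, |residual f (P.map (X 0)) n k (fun k => X k ω)| ∂P ≤
      2 * ∫ y, |f y| ∂(Measure.pi fun _ => P.map (X 0)) := by
  have := Measure.isProbabilityMeasure_map (hX 0).aemeasurable (μ := P)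
  set F := P.map (X 0)
  set C : ℝ := ((n - 1).choose (m - 1) : ℝ)
  have hC : 0 < C := Nat.cast_pos.2 (Nat.choose_pos (by omega))
  have hki (J) (hJ : J ∈ subsetsThrough m n k) :=
    (integrable_kernelOn hX hindep hident hf hfi (mem_subsetsThrough.1 hJ).2.1).abs
  have hci : Integrable (fun ω => |condMean f F (X k ω)|) P :=
    ((integrable_comp_iff hX hident k (measurable_condMean hf)).2 (integrable_condMean hm hfi)).abs
  have hval (J) (hJ : J ∈ subsetsThrough m n k) :
      ∫ ω, |kernelOn f J (fun k => X k ω)| ∂P = ∫ y, |f y| ∂(Measure.pi fun _ => F) :=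
    integral_kernelOn hX hindep hident hf (φ := fun x => |x|) measurable_id.abs
      (mem_subsetsThrough.1 hJ).2.1
  calc ∫ ω, |residual f F n k (fun k => X k ω)| ∂P
      ≤ ∫ ω, (C⁻¹ * ∑ J ∈ subsetsThrough m n k, |kernelOn f J (fun k => X k ω)| +
          |condMean f F (X k ω)|) ∂P := by
        refine integral_mono (integrable_residual hX hindep hident hm hf hfi n k).abs
          (((integrable_finsetSum _ hki).const_mul _).add hci) fun ω => ?_
        refine (abs_sub _ _).trans ?_
        simp only [averageThrough]
        rw [abs_mul, abs_of_pos (inv_pos.2 hC)]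
        gcongr
        exact abs_sum_le_sum_abs _ _
    _ = ∫ y, |f y| ∂(Measure.pi fun _ => F) + ∫ x, |condMean f F x| ∂F := by
        rw [integral_add ((integrable_finsetSum _ hki).const_mul _) hci, integral_const_mul,
          integral_finsetSum _ hki, sum_congr rfl hval, sum_const, card_subsetsThrough hm hk,
          nsmul_eq_mul, inv_mul_cancel_left₀ hC.ne',
          integral_comp_eq hX hident k (g := fun x => |condMean f F x|) (measurable_condMean hf).abs]
    _ ≤ 2 * ∫ y, |f y| ∂(Measure.pi fun _ => F) := by
        linarith [integral_abs_condMean_le hm hfi]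

/-- Pairs of sets meeting only in k contribute 0. Otherwise (a-c)(b-c) ≤ a^2 + b^2 + 2c^2, and each
of the three squares has mean at most that of f^2, whence the 4. The sum over l is a union bound on
"J and J' share another index", a form in which J' can be summed out. -/
theorem integral_centered_kernelOn_mul_le (hX : ∀ i, Measurable (X i)) (hindep : iIndepFun X P)
    (hident : ∀ i, IdentDistrib (X i) (X 0) P P) (hm : 1 ≤ m) {f : (Fin m → ℝ) → ℝ}
    (hf : Measurable f)
    (hsymm : ∀ (σ : Equiv.Perm (Fin m)) (x : Fin m → ℝ), f (fun j => x (σ j)) = f x)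
    {M : ℝ} (hM : ∀ y, |f y| ≤ M) {n k : ℕ} {J J' : Finset ℕ} (hJ : J ∈ subsetsThrough m n k)
    (hJ' : J' ∈ subsetsThrough m n k) :
    ∫ ω, (kernelOn f J (fun k => X k ω) - condMean f (P.map (X 0)) (X k ω)) *
        (kernelOn f J' (fun k => X k ω) - condMean f (P.map (X 0)) (X k ω)) ∂P ≤
      ∑ l ∈ J.erase k,
        if l ∈ J' then 4 * ∫ y, f y ^ 2 ∂(Measure.pi fun _ => P.map (X 0)) else 0 := by
  have := Measure.isProbabilityMeasure_map (hX 0).aemeasurable (μ := P)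
  set F := P.map (X 0)
  set V : ℝ := ∫ y, f y ^ 2 ∂(Measure.pi fun _ : Fin m => F)
  have hV : 0 ≤ V := integral_nonneg fun _ => sq_nonneg _
  have hnn : ∀ l ∈ J.erase k, 0 ≤ if l ∈ J' then 4 * V else 0 := fun l _ => by positivity
  by_cases hex : ∃ l ∈ J.erase k, l ∈ J'
  · obtain ⟨l, hl, hl'⟩ := hex
    refine le_trans ?_ (single_le_sum hnn hl)
    rw [if_pos hl']
    have hc := (measurable_condMean (F := F) hf).comp (hX k)
    have hki (J : Finset ℕ) : Integrable (fun ω => kernelOn f J (fun k => X k ω) ^ 2) P :=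
      integrable_of_abs_le ((measurable_kernelOn hX hf J).pow_const 2)
        fun ω => abs_sq_le_of_abs_le (abs_kernelOn_le hM J _)
    have hci : Integrable (fun ω => condMean f F (X k ω) ^ 2) P :=
      integrable_of_abs_le (hc.pow_const 2)
        fun ω => abs_sq_le_of_abs_le (abs_condMean_le_of_bound hM _)
    have hcb (J : Finset ℕ) (ω : Ω) :
        |kernelOn f J (fun k => X k ω) - condMean f F (X k ω)| ≤ M + M :=
      (abs_sub _ _).trans (add_le_add (abs_kernelOn_le hM J _) (abs_condMean_le_of_bound hM _))
    have hprod : Integrable (fun ω => (kernelOn f J (fun k => X k ω) - condMean f F (X k ω)) *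
        (kernelOn f J' (fun k => X k ω) - condMean f F (X k ω))) P := by
      refine integrable_of_abs_le (((measurable_kernelOn hX hf J).sub hc).mul
        ((measurable_kernelOn hX hf J').sub hc)) (M := (M + M) * (M + M)) fun ω => ?_
      rw [abs_mul]
      exact mul_le_mul (hcb _ _) (hcb _ _) (abs_nonneg _) ((abs_nonneg _).trans (hcb ∅ ω))
    have hsq (J : Finset ℕ) (hJ : J ∈ subsetsThrough m n k) :
        ∫ ω, kernelOn f J (fun k => X k ω) ^ 2 ∂P = V :=
      integral_kernelOn hX hindep hident hf (φ := fun x => x ^ 2) (by fun_prop)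
        (mem_subsetsThrough.1 hJ).2.1
    have hcsq : ∫ ω, condMean f F (X k ω) ^ 2 ∂P ≤ V := by
      rw [integral_comp_eq hX hident k (g := fun x => condMean f F x ^ 2)
        ((measurable_condMean hf).pow_const 2)]
      exact integral_condMean_sq_le hm hf hM
    have hadd : Integrable (fun ω => kernelOn f J (fun k => X k ω) ^ 2 +
        kernelOn f J' (fun k => X k ω) ^ 2) P := (hki J).add (hki J')
    calc _ ≤ ∫ ω, (kernelOn f J (fun k => X k ω) ^ 2 + kernelOn f J' (fun k => X k ω) ^ 2 +
          2 * condMean f F (X k ω) ^ 2) ∂P := by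
          refine integral_mono hprod (hadd.add (hci.const_mul 2)) fun ω => ?_
          simp only
          set a := kernelOn f J (fun k => X k ω)
          set b := kernelOn f J' (fun k => X k ω)
          set c := condMean f F (X k ω)
          nlinarith [sq_nonneg (a - b), sq_nonneg (a + c), sq_nonneg (b + c)]
      _ ≤ 4 * V := by
          rw [integral_add hadd (hci.const_mul 2),
            integral_add (hki J) (hki J'), integral_const_mul, hsq J hJ, hsq J' hJ']
          linarith
  · refine le_of_eq_of_le ?_ (sum_nonneg hnn)
    push Not at hex
    obtain ⟨i, hi, hiJ, hik⟩ := exists_tuple_of_mem_subsetsThrough hm hJ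
    obtain ⟨i', hi', hiJ', hik'⟩ := exists_tuple_of_mem_subsetsThrough hm hJ'
    rw [← integral_centered_mul_centered_eq_zero hX hindep hident hm hf hM hi hi' hik hik' ?_]
    · rw [← hiJ, ← hiJ']
      simp only [kernelOn_image hsymm hi, kernelOn_image hsymm hi']
      rfl
    · intro j j' hj' he
      have h1 : i' j' ∈ J' := hiJ' ▸ mem_image_of_mem _ (mem_univ j')
      refine hex (i' j') (mem_erase.2 ⟨fun h => hj' ?_, ?_⟩) h1
      · rw [hi' (h.trans hik'.symm)]
      · rw [← he, ← hiJ]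
        exact mem_image_of_mem _ (mem_univ j)

/-- Expanding the square gives an average over pairs (J, J'). For each of the m-1 indices l ≠ k of
J, only a fraction (m-1)/(n-1) of the J' contains l, so the factor n-1 is compensated. -/
theorem integral_residual_sq_le (hX : ∀ i, Measurable (X i)) (hindep : iIndepFun X P)
    (hident : ∀ i, IdentDistrib (X i) (X 0) P P) (hm : 1 ≤ m) {f : (Fin m → ℝ) → ℝ}
    (hf : Measurable f)
    (hsymm : ∀ (σ : Equiv.Perm (Fin m)) (x : Fin m → ℝ), f (fun j => x (σ j)) = f x)
    {M : ℝ} (hM : ∀ y, |f y| ≤ M) {n k : ℕ} (hmn : m ≤ n) (hk : k < n) :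
    ((n - 1 : ℕ) : ℝ) * ∫ ω, residual f (P.map (X 0)) n k (fun k => X k ω) ^ 2 ∂P ≤
      4 * (m : ℝ) ^ 2 * ∫ y, f y ^ 2 ∂(Measure.pi fun _ => P.map (X 0)) := by
  have := Measure.isProbabilityMeasure_map (hX 0).aemeasurable (μ := P)
  set F := P.map (X 0)
  set V : ℝ := ∫ y, f y ^ 2 ∂(Measure.pi fun _ : Fin m => F)
  have hV : 0 ≤ V := integral_nonneg fun _ => sq_nonneg _
  set C : ℝ := ((n - 1).choose (m - 1) : ℝ) with hCdef
  have hC : 0 < C := Nat.cast_pos.2 (Nat.choose_pos (by omega))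
  set g : Finset ℕ → Ω → ℝ := fun J ω => kernelOn f J (fun k => X k ω) - condMean f F (X k ω)
    with hg
  have hres (ω : Ω) : residual f F n k (fun k => X k ω) ^ 2 =
      (C⁻¹) ^ 2 * ∑ J ∈ subsetsThrough m n k, ∑ J' ∈ subsetsThrough m n k, g J ω * g J' ω := by
    rw [← sum_mul_sum, ← pow_two, ← mul_pow]
    congr 1
    simp only [hg, residual, averageThrough, sum_sub_distrib, sum_const, nsmul_eq_mul, mul_sub,
      card_subsetsThrough hm hk]
    rw [inv_mul_cancel_left₀ hC.ne']
  have hcb (J : Finset ℕ) (ω : Ω) : |g J ω| ≤ M + M :=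
    (abs_sub _ _).trans (add_le_add (abs_kernelOn_le hM J _) (abs_condMean_le_of_bound hM _))
  have hgm (J : Finset ℕ) : Measurable (g J) :=
    (measurable_kernelOn hX hf J).sub ((measurable_condMean hf).comp (hX k))
  have hprod (J J' : Finset ℕ) : Integrable (fun ω => g J ω * g J' ω) P := by
    refine integrable_of_abs_le ((hgm J).mul (hgm J')) (M := (M + M) * (M + M)) fun ω => ?_
    rw [abs_mul]
    exact mul_le_mul (hcb _ _) (hcb _ _) (abs_nonneg _) ((abs_nonneg _).trans (hcb ∅ ω))
  have hcount (J : Finset ℕ) (hJ : J ∈ subsetsThrough m n k) :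
      ((n - 1 : ℕ) : ℝ) * ∑ J' ∈ subsetsThrough m n k, ∫ ω, g J ω * g J' ω ∂P ≤
        (m : ℝ) ^ 2 * C * (4 * V) := by
    obtain ⟨hJn, hJc, hkJ⟩ := mem_subsetsThrough.1 hJ
    calc _ ≤ ((n - 1 : ℕ) : ℝ) * ∑ J' ∈ subsetsThrough m n k,
          ∑ l ∈ J.erase k, if l ∈ J' then 4 * V else 0 := by
          gcongr with J' hJ'
          exact integral_centered_kernelOn_mul_le hX hindep hident hm hf hsymm hM hJ hJ'
      _ = ∑ l ∈ J.erase k, (((n - 1) * #((subsetsThrough m n k).filter (l ∈ ·)) : ℕ) : ℝ) *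
            (4 * V) := by
          rw [sum_comm, mul_sum]
          refine sum_congr rfl fun l _ => ?_
          rw [← sum_filter, sum_const, nsmul_eq_mul]
          push_cast
          ring
      _ = ∑ l ∈ J.erase k, (((m - 1 : ℕ) : ℝ) * C) * (4 * V) := by
          refine sum_congr rfl fun l hl => ?_
          rw [card_filter_mem_subsetsThrough hm hmn hk
            (mem_range.1 (hJn (mem_of_mem_erase hl))) (ne_of_mem_erase hl).symm]
          push_cast
          rfl
      _ = ((m - 1 : ℕ) : ℝ) ^ 2 * C * (4 * V) := by
          rw [sum_const, card_erase_of_mem hkJ, hJc, nsmul_eq_mul]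
          ring
      _ ≤ (m : ℝ) ^ 2 * C * (4 * V) := by
          gcongr
          omega
  calc ((n - 1 : ℕ) : ℝ) * ∫ ω, residual f F n k (fun k => X k ω) ^ 2 ∂P
      = (C⁻¹) ^ 2 * ∑ J ∈ subsetsThrough m n k,
          ((n - 1 : ℕ) : ℝ) * ∑ J' ∈ subsetsThrough m n k, ∫ ω, g J ω * g J' ω ∂P := by
        simp_rw [hres]
        rw [integral_const_mul, integral_finsetSum _ fun J _ =>
          integrable_finsetSum _ fun J' _ => hprod J J', ← mul_sum]
        simp_rw [integral_finsetSum _ fun J' _ => hprod _ J']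
        ring
    _ ≤ (C⁻¹) ^ 2 * ∑ J ∈ subsetsThrough m n k, (m : ℝ) ^ 2 * C * (4 * V) := by
        exact mul_le_mul_of_nonneg_left (sum_le_sum hcount) (by positivity)
    _ = 4 * (m : ℝ) ^ 2 * V := by
        rw [sum_const, card_subsetsThrough hm hk, nsmul_eq_mul, ← hCdef]
        field_simp

end Sample

/-! ### Truncation of the kernel. -/

theorem averageThrough_add {m : ℕ} (f g : (Fin m → ℝ) → ℝ) (n k : ℕ) (x : ℕ → ℝ) :
    averageThrough (fun y => f y + g y) n k x =
      averageThrough f n k x + averageThrough g n k x := by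
  rw [averageThrough, averageThrough, averageThrough, ← mul_add, ← sum_add_distrib]
  congr 1
  refine sum_congr rfl fun J _ => ?_
  unfold kernelOn
  split_ifs <;> simp

/-- The kernel set to zero where its absolute value exceeds `L ^ 3`. -/
noncomputable def truncate {m : ℕ} (h : (Fin m → ℝ) → ℝ) (L : ℝ) (y : Fin m → ℝ) : ℝ :=
  if |h y| ≤ L ^ 3 then h y else 0

/-- The part of the kernel removed by the truncation. -/
noncomputable def tail {m : ℕ} (h : (Fin m → ℝ) → ℝ) (L : ℝ) (y : Fin m → ℝ) : ℝ :=
  if |h y| ≤ L ^ 3 then 0 else h y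

section Truncation

variable {m : ℕ} (h : (Fin m → ℝ) → ℝ) {L : ℝ}

theorem truncate_add_tail (L : ℝ) (y : Fin m → ℝ) : truncate h L y + tail h L y = h y := by
  unfold truncate tail
  split_ifs <;> simp

theorem abs_truncate_le (hL : 0 < L) (y : Fin m → ℝ) : |truncate h L y| ≤ L ^ 3 := by
  unfold truncate
  split_ifs with h1
  · exact h1
  · simpa using (pow_pos hL 3).le

/-- Below the threshold, |h|^2 = |h|^(1/3) |h|^(5/3) with |h|^(1/3) ≤ L; truncating at a cube keeps
this exponent integral. -/
theorem truncate_sq_le (hL : 0 < L) (y : Fin m → ℝ) :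
    truncate h L y ^ 2 ≤ L * |h y| ^ (5 / 3 : ℝ) := by
  unfold truncate
  split_ifs with h1
  · rw [← sq_abs]
    rcases (abs_nonneg (h y)).eq_or_lt with h0 | h0
    · rw [← h0, Real.zero_rpow (by norm_num)]
      simp
    · have h2 : |h y| ^ 2 = |h y| ^ (1 / 3 : ℝ) * |h y| ^ (5 / 3 : ℝ) := by
        rw [← Real.rpow_add h0, ← Real.rpow_natCast]
        norm_num
      rw [h2]
      gcongr
      calc |h y| ^ (1 / 3 : ℝ) ≤ (L ^ 3) ^ (1 / 3 : ℝ) := by gcongr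
        _ = L := by
          rw [← Real.rpow_natCast, ← Real.rpow_mul hL.le]
          norm_num
  · have := Real.rpow_nonneg (abs_nonneg (h y)) (5 / 3 : ℝ)
    simpa using mul_nonneg hL.le this

/-- Above the threshold |h|^(2/3) ≥ L^2, so |h| is dominated by L^(-2) |h|^(5/3). -/
theorem abs_tail_le (hL : 0 < L) (y : Fin m → ℝ) :
    |tail h L y| ≤ (L ^ 2)⁻¹ * |h y| ^ (5 / 3 : ℝ) := by
  unfold tail
  split_ifs with h1
  · have := Real.rpow_nonneg (abs_nonneg (h y)) (5 / 3 : ℝ)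
    rw [abs_zero]
    positivity
  · push Not at h1
    have h0 : 0 < |h y| := (pow_pos hL 3).trans h1
    have h2 : |h y| ^ (5 / 3 : ℝ) = |h y| ^ (2 / 3 : ℝ) * |h y| := by
      conv_rhs => rw [← Real.rpow_one |h y|, ← Real.rpow_mul h0.le, ← Real.rpow_add h0]
      norm_num
    rw [h2, ← mul_assoc, inv_mul_eq_div]
    refine le_mul_of_one_le_left h0.le ((one_le_div (by positivity)).2 ?_)
    calc L ^ 2 = (L ^ 3) ^ (2 / 3 : ℝ) := by
          rw [← Real.rpow_natCast, ← Real.rpow_natCast, ← Real.rpow_mul hL.le]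
          norm_num
      _ ≤ |h y| ^ (2 / 3 : ℝ) := by gcongr

variable {h}

theorem measurable_truncate (hh : Measurable h) : Measurable (truncate h L) :=
  Measurable.ite (measurableSet_le hh.abs measurable_const) hh measurable_const

theorem measurable_tail (hh : Measurable h) : Measurable (tail h L) :=
  Measurable.ite (measurableSet_le hh.abs measurable_const) measurable_const hh

theorem truncate_symm
    (hsymm : ∀ (σ : Equiv.Perm (Fin m)) (x : Fin m → ℝ), h (fun j => x (σ j)) = h x)
    (σ : Equiv.Perm (Fin m)) (x : Fin m → ℝ) :
    truncate h L (fun j => x (σ j)) = truncate h L x := by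
  simp only [truncate, hsymm]

variable {μ : Measure (Fin m → ℝ)}

theorem integrable_of_integrable_rpow [IsFiniteMeasure μ] (hh : Measurable h)
    (hI : Integrable (fun y => |h y| ^ (5 / 3 : ℝ)) μ) : Integrable h μ := by
  refine ((integrable_const (1 : ℝ)).add hI).mono' hh.aestronglyMeasurable
    (Eventually.of_forall fun y => ?_)
  rw [Real.norm_eq_abs, Pi.add_apply]
  have h0 := Real.rpow_nonneg (abs_nonneg (h y)) (5 / 3 : ℝ)
  rcases le_total |h y| 1 with h1 | h1
  · linarith
  · linarith [Real.self_le_rpow_of_one_le h1 (by norm_num : (1 : ℝ) ≤ 5 / 3)]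

theorem integral_truncate_sq_le [IsFiniteMeasure μ] (hL : 0 < L) (hh : Measurable h)
    (hI : Integrable (fun y => |h y| ^ (5 / 3 : ℝ)) μ) :
    ∫ y, truncate h L y ^ 2 ∂μ ≤ L * ∫ y, |h y| ^ (5 / 3 : ℝ) ∂μ := by
  rw [← integral_const_mul]
  exact integral_mono (integrable_of_abs_le ((measurable_truncate hh).pow_const 2)
    fun y => abs_sq_le_of_abs_le (abs_truncate_le h hL y)) (hI.const_mul L) (truncate_sq_le h hL)

theorem integrable_tail (hL : 0 < L) (hh : Measurable h)
    (hI : Integrable (fun y => |h y| ^ (5 / 3 : ℝ)) μ) : Integrable (tail h L) μ :=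
  (hI.const_mul _).mono' (measurable_tail hh).aestronglyMeasurable
    (Eventually.of_forall (abs_tail_le h hL))

theorem integral_abs_tail_le (hL : 0 < L) (hh : Measurable h)
    (hI : Integrable (fun y => |h y| ^ (5 / 3 : ℝ)) μ) :
    ∫ y, |tail h L y| ∂μ ≤ (L ^ 2)⁻¹ * ∫ y, |h y| ^ (5 / 3 : ℝ) ∂μ := by
  rw [← integral_const_mul]
  exact integral_mono (integrable_tail hL hh hI).abs (hI.const_mul _) (abs_tail_le h hL)

end Truncation

/-! ### Deterministic comparison of the two sums of squares. -/

theorem jackknife_factor_bounds {m n : ℝ} (hm : 1 ≤ m) (hn : 2 * m ≤ n) :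
    0 ≤ n * (n - 1) / (n - m) ^ 2 ∧ n * (n - 1) / (n - m) ^ 2 ≤ 4 ∧
      |n * (n - 1) / (n - m) ^ 2 - 1| ≤ 8 * m / n := by
  have hn0 : 0 < n := by linarith
  have hd : n / 2 ≤ n - m := by linarith
  have hd0 : 0 < n - m := by linarith
  have hd2 : n ^ 2 / 4 ≤ (n - m) ^ 2 := by
    have := pow_le_pow_left₀ (by positivity) hd 2
    linarith [this, div_pow n 2 2]
  refine ⟨div_nonneg (mul_nonneg hn0.le (by linarith)) (by positivity), ?_, ?_⟩
  · rw [div_le_iff₀ (by positivity)]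
    linarith
  · have : n * (n - 1) / (n - m) ^ 2 - 1 = ((2 * m - 1) * n - m ^ 2) / (n - m) ^ 2 := by
      field_simp
      ring
    rw [this, abs_div, abs_of_pos (by positivity : 0 < (n - m) ^ 2)]
    have h1 : m ^ 2 ≤ m * n := by nlinarith
    have h2 : n ≤ m * n := le_mul_of_one_le_left hn0.le hm
    calc _ ≤ (2 * m * n) / (n ^ 2 / 4) := by
          gcongr
          rw [abs_le]
          constructor <;> linarith [sq_nonneg m]
      _ = 8 * m / n := by field_simp; ring

/-- The values U - T_k are centred, so θ cancels and their sum of squares is ∑ (Y_k + R_k)^2 minus n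
times the squared mean of Y_k + R_k. The term 8m comes from the factor n(n-1)/(n-m)^2 not being 1,
and the other coefficients from its bound 4. -/
theorem abs_sum_sq_sub_le {n m : ℕ} (hm : 1 ≤ m) (hn : 2 * m ≤ n) {c l : ℝ} (hc : 0 < c)
    (hcl : c ≤ l) {θ U : ℝ} {T Y R : ℕ → ℝ} (hT : ∀ k, T k = θ + Y k + R k)
    (hU : (n : ℝ) * U = ∑ k ∈ range n, T k) :
    |((n : ℝ) - 1) / ((m : ℝ) ^ 2 * l ^ 2) *
        ∑ k ∈ range n, ((m : ℝ) / (n - m) * (U - T k)) ^ 2 -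
      1 / ((n : ℝ) * l ^ 2) * ∑ k ∈ range n, Y k ^ 2| ≤
    (c ^ 2)⁻¹ * ((8 * m + 4) * ((∑ k ∈ range n, Y k ^ 2) / (n * Real.sqrt n)) +
      16 * ((∑ k ∈ range n, R k ^ 2) / Real.sqrt n) + 8 * ((∑ k ∈ range n, Y k) / n) ^ 2) := by
  have hm0 : (1 : ℝ) ≤ m := by exact_mod_cast hm
  have hnm : 2 * (m : ℝ) ≤ n := by exact_mod_cast hn
  have hn0 : (0 : ℝ) < n := by linarith
  have hn1 : (1 : ℝ) ≤ n := by linarith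
  set s := Real.sqrt n
  have hs1 : 1 ≤ s := Real.one_le_sqrt.2 hn1
  have hs2 : s ^ 2 = n := Real.sq_sqrt hn0.le
  have hs0 : 0 < s := by linarith
  set SY := ∑ k ∈ range n, Y k ^ 2
  set SR := ∑ k ∈ range n, R k ^ 2
  set SYR := ∑ k ∈ range n, Y k * R k
  set y := (∑ k ∈ range n, Y k) / n
  set r := (∑ k ∈ range n, R k) / n
  have hSY : 0 ≤ SY := sum_nonneg fun _ _ => sq_nonneg _
  have hSR : 0 ≤ SR := sum_nonneg fun _ _ => sq_nonneg _
  have hy : ∑ k ∈ range n, Y k = n * y := by simp only [y]; field_simp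
  have hr : ∑ k ∈ range n, R k = n * r := by simp only [r]; field_simp
  have hUe : U = θ + y + r := by
    simp only [hT, sum_add_distrib, sum_const, card_range, nsmul_eq_mul, hy, hr] at hU
    exact mul_left_cancel₀ hn0.ne' (by linarith)
  have hV : ∑ k ∈ range n, (U - T k) ^ 2 = SY + 2 * SYR + SR - n * (y + r) ^ 2 := by
    have h1 (k : ℕ) : (U - T k) ^ 2 = Y k ^ 2 + 2 * (Y k * R k) + R k ^ 2 + (y + r) ^ 2 -
        2 * (y + r) * Y k - 2 * (y + r) * R k := by
      rw [hT, hUe]; ring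
    simp only [h1, sum_add_distrib, sum_sub_distrib, ← mul_sum, sum_const, card_range,
      nsmul_eq_mul, hy, hr]
    ring
  have hrR : n * r ^ 2 ≤ SR := by
    have := sq_sum_le_card_mul_sum_sq (s := range n) (f := R)
    rw [hr, card_range] at this
    have h2 : (n : ℝ) * (n * r ^ 2) ≤ n * SR := by nlinarith
    exact le_of_mul_le_mul_left h2 hn0
  -- Weighting the cross term by √n asks only for ∑ Y_k^2 = o(n^(3/2)) and ∑ R_k^2 = o(√n) in
  -- probability; no law of large numbers for Y_k^2 is involved.
  have hcross : |2 * SYR| ≤ SY / s + s * SR := by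
    simp only [SY, SR, SYR]
    rw [mul_sum, sum_div, mul_sum, ← sum_add_distrib]
    refine (abs_sum_le_sum_abs _ _).trans (sum_le_sum fun k _ => ?_)
    rw [abs_le]
    have e (ε : ℝ) (hε : ε ^ 2 = 1) :
        0 ≤ Y k ^ 2 / s + s * R k ^ 2 + 2 * ε * (Y k * R k) := by
      have : Y k ^ 2 / s + s * R k ^ 2 + 2 * ε * (Y k * R k) =
          (Y k + ε * s * R k) ^ 2 / s := by
        field_simp
        linear_combination (-(s ^ 2 * R k ^ 2)) * hε
      rw [this]
      positivity
    constructor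
    · linarith [e 1 (by norm_num)]
    · linarith [e (-1) (by norm_num)]
  have hV2 : |∑ k ∈ range n, (U - T k) ^ 2 - SY| ≤
      SY / s + s * SR + 3 * SR + 2 * n * y ^ 2 := by
    rw [hV]
    have h3 : n * (y + r) ^ 2 ≤ 2 * n * y ^ 2 + 2 * SR := by
      nlinarith [mul_nonneg hn0.le (sq_nonneg (y - r))]
    have h4 : 0 ≤ n * (y + r) ^ 2 := by positivity
    obtain ⟨h5, h6⟩ := abs_le.1 hcross
    have h7 : 0 ≤ (n : ℝ) * y ^ 2 := by positivity
    rw [abs_le]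
    constructor <;> linarith
  set V := ∑ k ∈ range n, (U - T k) ^ 2 with hVdef
  set a : ℝ := n * (n - 1) / (n - m) ^ 2
  obtain ⟨ha0, ha4, ha1⟩ := jackknife_factor_bounds hm0 hnm
  have hd0 : (0 : ℝ) < n - m := by linarith
  set a : ℝ := n * (n - 1) / (n - m) ^ 2 with ha
  have hl : 0 < l := hc.trans_le hcl
  have hmain : ((n : ℝ) - 1) / ((m : ℝ) ^ 2 * l ^ 2) *
        ∑ k ∈ range n, ((m : ℝ) / (n - m) * (U - T k)) ^ 2 - 1 / ((n : ℝ) * l ^ 2) * SY =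
      (l ^ 2)⁻¹ * ((a * (V - SY) + (a - 1) * SY) / n) := by
    simp only [mul_pow, ← mul_sum]
    rw [← hVdef]
    rw [ha]
    clear_value V s SY SR SYR y r
    field_simp
    ring
  rw [hmain, abs_mul, abs_of_pos (by positivity : 0 < (l ^ 2)⁻¹), abs_div, abs_of_pos hn0]
  have hcl2 : (l ^ 2)⁻¹ ≤ (c ^ 2)⁻¹ := by gcongr
  have hfin : |a * (V - SY) + (a - 1) * SY| ≤
      4 * (SY / s + s * SR + 3 * SR + 2 * n * y ^ 2) + 8 * m / n * SY := by
    refine (abs_add_le _ _).trans ?_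
    rw [abs_mul, abs_mul, abs_of_nonneg ha0, abs_of_nonneg hSY]
    gcongr
  refine mul_le_mul hcl2 ?_ (by positivity) (by positivity)
  rw [div_le_iff₀ hn0]
  refine hfin.trans ?_
  have e1 : SY / (n * s) * n = SY / s := by field_simp
  have e2 : SR / s * n = s * SR := by rw [← hs2]; field_simp
  have e3 : SR ≤ s * SR := le_mul_of_one_le_left hSR hs1
  have e4 : 8 * m / n * SY ≤ 8 * m * (SY / s) := by
    rw [← mul_div_assoc, div_mul_eq_mul_div]
    gcongr
    nlinarith
  calc _ ≤ 4 * (SY / s + s * SR + 3 * (s * SR) + 2 * n * y ^ 2) + 8 * m * (SY / s) := by gcongr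
    _ = (8 * m + 4) * (SY / (n * s) * n) + 16 * (SR / s * n) + 8 * y ^ 2 * n := by
        rw [e1, e2]; ring
    _ = _ := by ring

/-! ### Convergence to zero in probability. -/

section InMeasure

variable {Ω : Type*} [MeasurableSpace Ω] {P : Measure Ω}

theorem tendstoInMeasure_zero_of_integral_le [IsFiniteMeasure P] {W : ℕ → Ω → ℝ} {b : ℕ → ℝ}
    (h0 : ∀ n ω, 0 ≤ W n ω)
    (hW : ∀ᶠ n in atTop, Integrable (W n) P ∧ ∫ ω, W n ω ∂P ≤ b n)
    (hb : Tendsto b atTop (𝓝 0)) : TendstoInMeasure P W atTop (fun _ => (0 : ℝ)) := by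
  rw [tendstoInMeasure_iff_measureReal_norm]
  intro ε hε
  refine squeeze_zero' (Eventually.of_forall fun _ => measureReal_nonneg)
    (hW.mono fun n hn => ?_) (by simpa using hb.div_const ε)
  rw [le_div_iff₀' hε]
  refine le_trans (le_of_eq ?_)
    ((mul_meas_ge_le_integral_of_nonneg (Eventually.of_forall (h0 n)) hn.1 ε).trans hn.2)
  simp only [sub_zero, Real.norm_eq_abs, abs_of_nonneg (h0 n _)]

theorem tendstoInMeasure_zero_of_le {D W : ℕ → Ω → ℝ}
    (hD : ∀ᶠ n in atTop, ∀ᵐ ω ∂P, |D n ω| ≤ |W n ω|)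
    (hW : TendstoInMeasure P W atTop (fun _ => (0 : ℝ))) :
    TendstoInMeasure P D atTop (fun _ => (0 : ℝ)) := by
  rw [tendstoInMeasure_iff_norm] at hW ⊢
  intro ε hε
  refine tendsto_of_tendsto_of_tendsto_of_le_of_le' tendsto_const_nhds (hW ε hε)
    (Eventually.of_forall fun _ => zero_le) (hD.mono fun n hn => measure_mono_ae ?_)
  filter_upwards [hn] with ω h1 h2
  simp only [sub_zero, Real.norm_eq_abs] at h2 ⊢
  exact le_trans h2 h1

theorem tendstoInMeasure_add_zero {V W : ℕ → Ω → ℝ}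
    (hV : TendstoInMeasure P V atTop (fun _ => (0 : ℝ)))
    (hW : TendstoInMeasure P W atTop (fun _ => (0 : ℝ))) :
    TendstoInMeasure P (fun n ω => V n ω + W n ω) atTop (fun _ => (0 : ℝ)) := by
  rw [tendstoInMeasure_iff_norm] at hV hW ⊢
  intro ε hε
  have h1 := (hV (ε / 2) (by positivity)).add (hW (ε / 2) (by positivity))
  rw [_root_.add_zero] at h1
  refine tendsto_of_tendsto_of_tendsto_of_le_of_le tendsto_const_nhds h1 (fun _ => zero_le)
    fun n => (measure_mono fun ω h2 => ?_).trans (measure_union_le _ _)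
  simp only [sub_zero, Real.norm_eq_abs, Set.mem_ofPred_eq, Set.mem_union] at h2 ⊢
  by_contra! hcon
  linarith [abs_add_le (V n ω) (W n ω)]

theorem tendstoInMeasure_sq_zero {W : ℕ → Ω → ℝ}
    (hW : TendstoInMeasure P W atTop (fun _ => (0 : ℝ))) :
    TendstoInMeasure P (fun n ω => W n ω ^ 2) atTop (fun _ => (0 : ℝ)) := by
  rw [tendstoInMeasure_iff_norm] at hW ⊢
  intro ε hε
  refine tendsto_of_tendsto_of_tendsto_of_le_of_le tendsto_const_nhds
    (hW (Real.sqrt ε) (Real.sqrt_pos.2 hε)) (fun _ => zero_le) fun n => measure_mono fun ω h2 => ?_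
  simp only [sub_zero, Real.norm_eq_abs, Set.mem_ofPred_eq, abs_pow] at h2 ⊢
  exact (Real.sqrt_le_left (abs_nonneg _)).2 h2

theorem tendstoInMeasure_const_mul_zero {W : ℕ → Ω → ℝ} (K : ℝ)
    (hW : TendstoInMeasure P W atTop (fun _ => (0 : ℝ))) :
    TendstoInMeasure P (fun n ω => K * W n ω) atTop (fun _ => (0 : ℝ)) := by
  rw [tendstoInMeasure_iff_norm] at hW ⊢
  intro ε hε
  refine tendsto_of_tendsto_of_tendsto_of_le_of_le tendsto_const_nhds
    (hW (ε / (|K| + 1)) (by positivity)) (fun _ => zero_le) fun n => measure_mono fun ω h2 => ?_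
  simp only [sub_zero, Real.norm_eq_abs, Set.mem_ofPred_eq, abs_mul] at h2 ⊢
  rw [div_le_iff₀ (by positivity)]
  nlinarith [abs_nonneg (W n ω)]

theorem tendstoInMeasure_zero_of_tendsto {b : ℕ → ℝ} (hb : Tendsto b atTop (𝓝 0)) :
    TendstoInMeasure P (fun n (_ : Ω) => b n) atTop (fun _ => (0 : ℝ)) := by
  rw [tendstoInMeasure_iff_norm]
  intro ε hε
  refine tendsto_const_nhds.congr' ?_
  have := (tendsto_zero_iff_abs_tendsto_zero b).1 hb
  filter_upwards [this.eventually_lt_const hε] with n hn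
  simp only [Function.comp_apply] at hn
  simp [not_le.2 hn]

end InMeasure

/-! ### Limits for the truncated and tail parts. -/

theorem integrable_and_integral_sum_div_le {Ω : Type*} [MeasurableSpace Ω] {P : Measure Ω}
    {G : ℕ → Ω → ℝ} {n : ℕ} {v d : ℝ} (hd : 0 ≤ d)
    (hG : ∀ k < n, Integrable (G k) P ∧ ∫ ω, G k ω ∂P ≤ v) :
    Integrable (fun ω => (∑ k ∈ range n, G k ω) / d) P ∧
      ∫ ω, (∑ k ∈ range n, G k ω) / d ∂P ≤ n * v / d := by
  have hGi : ∀ k ∈ range n, Integrable (G k) P := fun k hk => (hG k (mem_range.1 hk)).1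
  refine ⟨(integrable_finsetSum _ hGi).div_const _, ?_⟩
  rw [integral_div, integral_finsetSum _ hGi]
  gcongr
  refine (sum_le_sum fun k hk => (hG k (mem_range.1 hk)).2).trans_eq ?_
  simp

section Limit

variable {Ω : Type*} [MeasurableSpace Ω] {P : Measure Ω} [IsProbabilityMeasure P]
  {X : ℕ → Ω → ℝ} {m : ℕ} {h : (Fin m → ℝ) → ℝ}

/-- Integrability of the section matters: without it both integrals take the default value 0 and the
two sides differ by θ. The identity is therefore used only almost surely. -/
theorem proj_eq_condMean_sub {F : Measure ℝ} [IsProbabilityMeasure F] {x : ℝ}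
    (hx : Integrable (fun y => h (replaceFirst x y)) (Measure.pi fun _ : Fin m => F)) :
    proj h F x = condMean h F x - theta h F := by
  change ∫ y, (h (replaceFirst x y) - theta h F) ∂_ = _
  rw [integral_sub hx (integrable_const _)]
  simp [condMean]

theorem ae_forall_integrable_section (hX : ∀ i, Measurable (X i))
    (hident : ∀ i, IdentDistrib (X i) (X 0) P P) (hm : 1 ≤ m)
    (hi : Integrable h (Measure.pi fun _ => P.map (X 0))) :
    ∀ᵐ ω ∂P, ∀ k, Integrable (fun y => h (replaceFirst (X k ω) y))
      (Measure.pi fun _ : Fin m => P.map (X 0)) := by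
  have := Measure.isProbabilityMeasure_map (hX 0).aemeasurable (μ := P)
  refine ae_all_iff.2 fun k => ?_
  refine ae_of_ae_map (hX k).aemeasurable (p := fun x => Integrable (fun y =>
    h (replaceFirst x y)) (Measure.pi fun _ : Fin m => P.map (X 0))) ?_
  rw [(hident k).map_eq]
  exact ae_integrable_section hm hi

theorem measurable_proj (hh : Measurable h) {F : Measure ℝ} [IsProbabilityMeasure F] :
    Measurable (proj h F) := by
  have : StronglyMeasurable
      (fun p : ℝ × (Fin m → ℝ) => h (replaceFirst p.1 p.2) - theta h F) :=
    ((hh.comp measurable_replaceFirst).sub_const _).stronglyMeasurable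
  exact this.integral_prod_right'.measurable

theorem identDistrib_proj (hh : Measurable h) (hX : ∀ i, Measurable (X i))
    (hident : ∀ i, IdentDistrib (X i) (X 0) P P) (i : ℕ) :
    IdentDistrib (fun ω => proj h (P.map (X 0)) (X i ω))
      (fun ω => proj h (P.map (X 0)) (X 0 ω)) P P := by
  have := Measure.isProbabilityMeasure_map (hX 0).aemeasurable (μ := P)
  exact (hident i).comp (measurable_proj hh)

theorem iIndepFun_proj (hh : Measurable h) (hX : ∀ i, Measurable (X i)) (hindep : iIndepFun X P) :
    iIndepFun (fun i ω => proj h (P.map (X 0)) (X i ω)) P := by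
  have := Measure.isProbabilityMeasure_map (hX 0).aemeasurable (μ := P)
  exact hindep.comp (fun _ => proj h (P.map (X 0))) fun _ => measurable_proj hh

theorem tendstoInMeasure_mean_proj (hX : ∀ i, Measurable (X i)) (hindep : iIndepFun X P)
    (hident : ∀ i, IdentDistrib (X i) (X 0) P P) (hm : 1 ≤ m) (hh : Measurable h)
    (hi : Integrable h (Measure.pi fun _ => P.map (X 0))) :
    TendstoInMeasure P
      (fun n ω => (∑ i ∈ range n, proj h (P.map (X 0)) (X i ω)) / n) atTop
      (fun _ => (0 : ℝ)) := by
  have := Measure.isProbabilityMeasure_map (hX 0).aemeasurable (μ := P)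
  set F := P.map (X 0)
  have hci : Integrable (fun ω => condMean h F (X 0 ω)) P :=
    (integrable_comp_iff hX hident 0 (measurable_condMean hh)).2 (integrable_condMean hm hi)
  have hae : (fun ω => proj h F (X 0 ω)) =ᵐ[P] fun ω => condMean h F (X 0 ω) - theta h F := by
    filter_upwards [ae_forall_integrable_section hX hident hm hi] with ω hω
    exact proj_eq_condMean_sub (hω 0)
  have hmean : ∫ ω, proj h F (X 0 ω) ∂P = 0 := by
    rw [integral_congr_ae hae, integral_sub hci (integrable_const _),
      integral_comp_eq hX hident 0 (measurable_condMean hh), integral_condMean hm hi]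
    simp [theta]
  have hslln := strong_law_ae_real (fun i ω => proj h F (X i ω))
    ((integrable_congr hae).2 (hci.sub (integrable_const _)))
    (fun i j hij => (iIndepFun_proj hh hX hindep).indepFun hij)
    (identDistrib_proj hh hX hident)
  rw [hmean] at hslln
  refine tendstoInMeasure_of_tendsto_ae (fun n => ?_) hslln
  refine Measurable.aestronglyMeasurable (Measurable.div_const ?_ _)
  exact Finset.measurable_fun_sum _ fun i _ => (measurable_proj hh).comp (hX i)

/-- The scale `n ^ (1 / 16)`; powers of it serve as truncation level and as norming. -/
noncomputable def scale (n : ℕ) : ℝ := (n : ℝ) ^ (1 / 16 : ℝ)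

theorem scale_nonneg (n : ℕ) : 0 ≤ scale n := Real.rpow_nonneg (Nat.cast_nonneg n) _

theorem scale_pow (n : ℕ) : scale n ^ 16 = n := by
  rw [scale, ← Real.rpow_natCast, ← Real.rpow_mul (Nat.cast_nonneg n)]
  norm_num

theorem scale_pow_eight (n : ℕ) : scale n ^ 8 = Real.sqrt n := by
  rw [eq_comm, Real.sqrt_eq_iff_mul_self_eq (Nat.cast_nonneg n) (pow_nonneg (scale_nonneg n) 8),
    ← pow_add, scale_pow]

theorem one_le_scale {n : ℕ} (hn : 1 ≤ n) : 1 ≤ scale n :=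
  Real.one_le_rpow (by exact_mod_cast hn) (by norm_num)

theorem tendsto_scale_inv (K : ℝ) : Tendsto (fun n => K / scale n) atTop (𝓝 0) :=
  tendsto_const_nhds.div_atTop
    ((tendsto_rpow_atTop (by norm_num)).comp tendsto_natCast_atTop_atTop)

/-- With s = `scale n` and L = s^7, the mean is at most s^16 * s^7 * I / s^24 = I / s. Among powers
L = s^a, this bound and the one for the truncated residual need a < 8, while the tail of the
residual needs a > 6; hence 7. -/
theorem tendstoInMeasure_condMean_truncate
    (hX : ∀ i, Measurable (X i)) (hident : ∀ i, IdentDistrib (X i) (X 0) P P) (hm : 1 ≤ m)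
    (hh : Measurable h)
    (hI : Integrable (fun y => |h y| ^ (5 / 3 : ℝ)) (Measure.pi fun _ : Fin m => P.map (X 0))) :
    TendstoInMeasure P (fun n ω => (∑ k ∈ range n,
      condMean (truncate h (scale n ^ 7)) (P.map (X 0)) (X k ω) ^ 2) / (n * Real.sqrt n)) atTop
      (fun _ => (0 : ℝ)) := by
  have := Measure.isProbabilityMeasure_map (hX 0).aemeasurable (μ := P)
  set F := P.map (X 0)
  set I := ∫ y, |h y| ^ (5 / 3 : ℝ) ∂(Measure.pi fun _ : Fin m => F)
  refine tendstoInMeasure_zero_of_integral_le (b := fun n => I / scale n)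
    (fun n ω => div_nonneg (sum_nonneg fun _ _ => sq_nonneg _) (by positivity)) ?_
    (tendsto_scale_inv I)
  filter_upwards [eventually_ge_atTop 1] with n hn
  have hs : 0 < scale n := zero_lt_one.trans_le (one_le_scale hn)
  have hL : 0 < scale n ^ 7 := pow_pos hs 7
  have hq := measurable_condMean (F := F) (measurable_truncate (L := scale n ^ 7) hh)
  have h1 := integrable_and_integral_sum_div_le (P := P) (n := n) (v := scale n ^ 7 * I)
    (d := n * Real.sqrt n)
    (G := fun k ω => condMean (truncate h (scale n ^ 7)) F (X k ω) ^ 2) (by positivity)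
    fun k _ => ⟨integrable_of_abs_le ((hq.comp (hX k)).pow_const 2) fun ω =>
      abs_sq_le_of_abs_le (abs_condMean_le_of_bound (abs_truncate_le h hL) _), by
      rw [integral_comp_eq hX hident k (g := fun x => condMean (truncate h (scale n ^ 7)) F x ^ 2)
        (hq.pow_const 2)]
      exact (integral_condMean_sq_le hm (measurable_truncate hh) (abs_truncate_le h hL)).trans
        (integral_truncate_sq_le hL hh hI)⟩
  refine ⟨h1.1, h1.2.trans_eq ?_⟩
  rw [← scale_pow_eight, ← scale_pow]
  field_simp

/-- The norming s^12 is the square root of n^(3/2) = s^24, since the ratio is squared later. -/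
theorem tendstoInMeasure_condMean_tail
    (hX : ∀ i, Measurable (X i)) (hident : ∀ i, IdentDistrib (X i) (X 0) P P) (hm : 1 ≤ m)
    (hh : Measurable h)
    (hI : Integrable (fun y => |h y| ^ (5 / 3 : ℝ)) (Measure.pi fun _ : Fin m => P.map (X 0))) :
    TendstoInMeasure P (fun n ω => (∑ k ∈ range n,
      |condMean (tail h (scale n ^ 7)) (P.map (X 0)) (X k ω)|) / scale n ^ 12) atTop
      (fun _ => (0 : ℝ)) := by
  have := Measure.isProbabilityMeasure_map (hX 0).aemeasurable (μ := P)
  set F := P.map (X 0)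
  set I := ∫ y, |h y| ^ (5 / 3 : ℝ) ∂(Measure.pi fun _ : Fin m => F)
  have hI0 : 0 ≤ I := integral_nonneg fun _ => Real.rpow_nonneg (abs_nonneg _) _
  refine tendstoInMeasure_zero_of_integral_le (b := fun n => I / scale n)
    (fun n ω => div_nonneg (sum_nonneg fun _ _ => abs_nonneg _) (pow_nonneg (scale_nonneg n) _))
    ?_ (tendsto_scale_inv I)
  filter_upwards [eventually_ge_atTop 1] with n hn
  have hs1 := one_le_scale hn
  have hs : 0 < scale n := zero_lt_one.trans_le hs1
  have hL : 0 < scale n ^ 7 := pow_pos hs 7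
  have hq := measurable_condMean (F := F) (measurable_tail (L := scale n ^ 7) hh)
  have hti := integrable_tail hL hh hI
  have h1 := integrable_and_integral_sum_div_le (P := P) (n := n)
    (v := ((scale n ^ 7) ^ 2)⁻¹ * I) (d := scale n ^ 12)
    (G := fun k ω => |condMean (tail h (scale n ^ 7)) F (X k ω)|) (by positivity)
    fun k _ => ⟨((integrable_comp_iff hX hident k hq).2 (integrable_condMean hm hti)).abs, by
      rw [integral_comp_eq hX hident k (g := fun x => |condMean (tail h (scale n ^ 7)) F x|) hq.abs]
      exact (integral_abs_condMean_le hm hti).trans (integral_abs_tail_le hL hh hI)⟩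
  refine ⟨h1.1, h1.2.trans ?_⟩
  calc (n : ℝ) * (((scale n ^ 7) ^ 2)⁻¹ * I) / scale n ^ 12 = I / scale n ^ 10 := by
        rw [← scale_pow]
        field_simp
    _ ≤ I / scale n := by
        gcongr
        exact le_self_pow₀ hs1 (by norm_num)

theorem tendstoInMeasure_residual_truncate
    (hX : ∀ i, Measurable (X i)) (hindep : iIndepFun X P)
    (hident : ∀ i, IdentDistrib (X i) (X 0) P P) (hm : 1 ≤ m) (hh : Measurable h)
    (hI : Integrable (fun y => |h y| ^ (5 / 3 : ℝ)) (Measure.pi fun _ : Fin m => P.map (X 0)))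
    (hsymm : ∀ (σ : Equiv.Perm (Fin m)) (x : Fin m → ℝ), h (fun j => x (σ j)) = h x) :
    TendstoInMeasure P (fun n ω => (∑ k ∈ range n,
      residual (truncate h (scale n ^ 7)) (P.map (X 0)) n k (fun k => X k ω) ^ 2) / Real.sqrt n)
      atTop (fun _ => (0 : ℝ)) := by
  have := Measure.isProbabilityMeasure_map (hX 0).aemeasurable (μ := P)
  set F := P.map (X 0)
  set I := ∫ y, |h y| ^ (5 / 3 : ℝ) ∂(Measure.pi fun _ : Fin m => F)
  have hI0 : 0 ≤ I := integral_nonneg fun _ => Real.rpow_nonneg (abs_nonneg _) _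
  refine tendstoInMeasure_zero_of_integral_le (b := fun n => (8 * (m : ℝ) ^ 2 * I) / scale n)
    (fun n ω => div_nonneg (sum_nonneg fun _ _ => sq_nonneg _) (by positivity)) ?_
    (tendsto_scale_inv _)
  filter_upwards [eventually_ge_atTop (max 2 m)] with n hn
  have hn2 : 2 ≤ n := (le_max_left _ _).trans hn
  have hnm : m ≤ n := (le_max_right _ _).trans hn
  have hn2' : (2 : ℝ) ≤ n := by exact_mod_cast hn2
  have hs : 0 < scale n := zero_lt_one.trans_le (one_le_scale (by omega))
  have hL : 0 < scale n ^ 7 := pow_pos hs 7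
  have htm := measurable_truncate (L := scale n ^ 7) hh
  have hb := abs_truncate_le h hL
  have h1 := integrable_and_integral_sum_div_le (P := P) (n := n)
    (v := 8 * (m : ℝ) ^ 2 * (scale n ^ 7 * I) / n) (d := Real.sqrt n)
    (G := fun k ω => residual (truncate h (scale n ^ 7)) F n k (fun k => X k ω) ^ 2)
    (by positivity) fun k hk => by
      constructor
      · have hav (ω : Ω) : |averageThrough (truncate h (scale n ^ 7)) n k (fun k => X k ω)| ≤
            ((n - 1).choose (m - 1) : ℝ)⁻¹ *
              ∑ J ∈ subsetsThrough m n k, (scale n ^ 7) ^ 3 := by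
          rw [averageThrough, abs_mul, abs_of_nonneg (by positivity)]
          gcongr
          exact (abs_sum_le_sum_abs _ _).trans (sum_le_sum fun J _ => abs_kernelOn_le hb J _)
        refine integrable_of_abs_le (Measurable.pow_const (Measurable.sub
          (measurable_const.mul (Finset.measurable_fun_sum _ fun J _ =>
            measurable_kernelOn hX htm J)) ((measurable_condMean htm).comp (hX k))) 2)
          fun ω => abs_sq_le_of_abs_le ((abs_sub _ _).trans (add_le_add (hav ω)
            (abs_condMean_le_of_bound hb _)))
      · have h2 := integral_residual_sq_le hX hindep hident hm htm (truncate_symm hsymm) hb hnm hk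
        have h3 := integral_truncate_sq_le hL hh hI
        rw [Nat.cast_sub (by omega), Nat.cast_one] at h2
        set Q := ∫ ω, residual (truncate h (scale n ^ 7)) F n k (fun k => X k ω) ^ 2 ∂P
        have hQ : 0 ≤ Q := integral_nonneg fun _ => sq_nonneg _
        rw [le_div_iff₀ (by linarith)]
        have h4 : 4 * (m : ℝ) ^ 2 *
            ∫ y, truncate h (scale n ^ 7) y ^ 2 ∂(Measure.pi fun _ : Fin m => F) ≤
            4 * (m : ℝ) ^ 2 * (scale n ^ 7 * I) := by gcongr
        -- For n ≥ 2 one has n ≤ 2(n-1), which turns the constant 4 into 8.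
        have h5 : Q * n ≤ 2 * (((n : ℝ) - 1) * Q) := by nlinarith
        linarith
  refine ⟨h1.1, h1.2.trans_eq ?_⟩
  rw [← scale_pow_eight]
  field_simp

/-- The norming s^4 is the square root of √n = s^8. The mean is at most 2 s^16 * s^(-14) * I / s^4 =
2I / s^2. -/
theorem tendstoInMeasure_residual_tail
    (hX : ∀ i, Measurable (X i)) (hindep : iIndepFun X P)
    (hident : ∀ i, IdentDistrib (X i) (X 0) P P) (hm : 1 ≤ m) (hh : Measurable h)
    (hI : Integrable (fun y => |h y| ^ (5 / 3 : ℝ)) (Measure.pi fun _ : Fin m => P.map (X 0))) :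
    TendstoInMeasure P (fun n ω => (∑ k ∈ range n,
      |residual (tail h (scale n ^ 7)) (P.map (X 0)) n k (fun k => X k ω)|) / scale n ^ 4) atTop
      (fun _ => (0 : ℝ)) := by
  have := Measure.isProbabilityMeasure_map (hX 0).aemeasurable (μ := P)
  set F := P.map (X 0)
  set I := ∫ y, |h y| ^ (5 / 3 : ℝ) ∂(Measure.pi fun _ : Fin m => F)
  have hI0 : 0 ≤ I := integral_nonneg fun _ => Real.rpow_nonneg (abs_nonneg _) _
  refine tendstoInMeasure_zero_of_integral_le (b := fun n => 2 * I / scale n)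
    (fun n ω => div_nonneg (sum_nonneg fun _ _ => abs_nonneg _) (pow_nonneg (scale_nonneg n) _))
    ?_ (tendsto_scale_inv _)
  filter_upwards [eventually_ge_atTop m] with n hn
  have hs1 := one_le_scale (hm.trans hn)
  have hs : 0 < scale n := zero_lt_one.trans_le hs1
  have hL : 0 < scale n ^ 7 := pow_pos hs 7
  have htm := measurable_tail (L := scale n ^ 7) hh
  have hti := integrable_tail hL hh hI
  have h1 := integrable_and_integral_sum_div_le (P := P) (n := n)
    (v := 2 * (((scale n ^ 7) ^ 2)⁻¹ * I)) (d := scale n ^ 4)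
    (G := fun k ω => |residual (tail h (scale n ^ 7)) F n k (fun k => X k ω)|) (by positivity)
    fun k hk => ⟨(integrable_residual hX hindep hident hm htm hti n k).abs,
      (integral_abs_residual_le hX hindep hident hm htm hti hn hk).trans (by
        gcongr
        exact integral_abs_tail_le hL hh hI)⟩
  refine ⟨h1.1, h1.2.trans ?_⟩
  calc (n : ℝ) * (2 * (((scale n ^ 7) ^ 2)⁻¹ * I)) / scale n ^ 4 = 2 * I / scale n ^ 2 := by
        rw [← scale_pow]
        field_simp
    _ ≤ 2 * I / scale n := by
        gcongr
        exact le_self_pow₀ hs1 (by norm_num)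

end Limit

/-! ### Recombining the truncated and tail parts. -/

theorem sum_sq_le_sq_sum_abs (s : Finset ℕ) (a : ℕ → ℝ) :
    ∑ k ∈ s, a k ^ 2 ≤ (∑ k ∈ s, |a k|) ^ 2 := by
  simp_rw [← sq_abs (a _)]
  exact sum_sq_le_sq_sum_of_nonneg fun _ _ => abs_nonneg _

/-- Norming of the squares of a sum of two parts, one controlled in square mean and the other in
mean. -/
theorem sum_sq_add_div_le (n : ℕ) (p q : ℕ → ℝ) {d e : ℝ} (hd : 0 < d) (he : e ^ 2 = d) :
    (∑ k ∈ range n, (p k + q k) ^ 2) / d ≤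
      2 * ((∑ k ∈ range n, p k ^ 2) / d) + 2 * ((∑ k ∈ range n, |q k|) / e) ^ 2 := by
  rw [div_pow, he, ← mul_div_assoc, ← mul_div_assoc, ← add_div]
  gcongr
  calc ∑ k ∈ range n, (p k + q k) ^ 2 ≤ ∑ k ∈ range n, (2 * p k ^ 2 + 2 * q k ^ 2) :=
        sum_le_sum fun k _ => by nlinarith [sq_nonneg (p k - q k)]
    _ = 2 * ∑ k ∈ range n, p k ^ 2 + 2 * ∑ k ∈ range n, q k ^ 2 := by
        rw [sum_add_distrib, mul_sum, mul_sum]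
    _ ≤ _ := by
        gcongr
        exact sum_sq_le_sq_sum_abs _ _

section Limit

variable {Ω : Type*} [MeasurableSpace Ω] {P : Measure Ω} [IsProbabilityMeasure P]
  {X : ℕ → Ω → ℝ} {m : ℕ} {h : (Fin m → ℝ) → ℝ}

theorem condMean_eq_truncate_add_tail {F : Measure ℝ} [IsProbabilityMeasure F] (hh : Measurable h)
    {L : ℝ} (hL : 0 < L) {x : ℝ}
    (hx : Integrable (fun y => h (replaceFirst x y)) (Measure.pi fun _ : Fin m => F)) :
    condMean h F x = condMean (truncate h L) F x + condMean (tail h L) F x := by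
  have h1 : Integrable (fun y => truncate h L (replaceFirst x y))
      (Measure.pi fun _ : Fin m => F) :=
    integrable_of_abs_le ((measurable_truncate hh).comp (measurable_replaceFirst_right x))
      fun y => abs_truncate_le h hL _
  have h2 : (fun y => tail h L (replaceFirst x y)) =
      fun y => h (replaceFirst x y) - truncate h L (replaceFirst x y) := by
    funext y
    rw [← truncate_add_tail h L (replaceFirst x y)]
    ring
  have h3 : Integrable (fun y => tail h L (replaceFirst x y)) (Measure.pi fun _ : Fin m => F) := by
    rw [h2]
    exact hx.sub h1
  rw [condMean, condMean, condMean, ← integral_add h1 h3]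
  simp only [truncate_add_tail]

theorem residual_eq_truncate_add_tail {F : Measure ℝ} [IsProbabilityMeasure F] (hh : Measurable h)
    {L : ℝ} (hL : 0 < L) {n k : ℕ} {x : ℕ → ℝ}
    (hx : Integrable (fun y => h (replaceFirst (x k) y)) (Measure.pi fun _ : Fin m => F)) :
    residual h F n k x = residual (truncate h L) F n k x + residual (tail h L) F n k x := by
  have h1 : averageThrough h n k x =
      averageThrough (truncate h L) n k x + averageThrough (tail h L) n k x := by
    rw [← averageThrough_add]
    simp only [truncate_add_tail]
  rw [residual, residual, residual, h1, condMean_eq_truncate_add_tail hh hL hx]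
  ring

theorem tendstoInMeasure_sum_residual_sq (hX : ∀ i, Measurable (X i)) (hindep : iIndepFun X P)
    (hident : ∀ i, IdentDistrib (X i) (X 0) P P) (hm : 1 ≤ m) (hh : Measurable h)
    (hI : Integrable (fun y => |h y| ^ (5 / 3 : ℝ)) (Measure.pi fun _ : Fin m => P.map (X 0)))
    (hsymm : ∀ (σ : Equiv.Perm (Fin m)) (x : Fin m → ℝ), h (fun j => x (σ j)) = h x) :
    TendstoInMeasure P (fun n ω => (∑ k ∈ range n,
      residual h (P.map (X 0)) n k (fun k => X k ω) ^ 2) / Real.sqrt n)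
      atTop (fun _ => (0 : ℝ)) := by
  have := Measure.isProbabilityMeasure_map (hX 0).aemeasurable (μ := P)
  refine tendstoInMeasure_zero_of_le ?_ (tendstoInMeasure_add_zero
    (tendstoInMeasure_const_mul_zero 2
      (tendstoInMeasure_residual_truncate hX hindep hident hm hh hI hsymm))
    (tendstoInMeasure_const_mul_zero 2 (tendstoInMeasure_sq_zero
      (tendstoInMeasure_residual_tail hX hindep hident hm hh hI))))
  filter_upwards [eventually_ge_atTop 1] with n hn
  filter_upwards [ae_forall_integrable_section hX hident hm
    (integrable_of_integrable_rpow hh hI)] with ω hω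
  have hs : 0 < scale n := zero_lt_one.trans_le (one_le_scale hn)
  have hn0 : (0 : ℝ) < n := by exact_mod_cast hn
  rw [abs_of_nonneg (div_nonneg (sum_nonneg fun _ _ => sq_nonneg _) (by positivity))]
  refine le_trans ?_ (le_abs_self _)
  simp only [fun k => residual_eq_truncate_add_tail (n := n) (k := k) (x := fun k => X k ω) hh
    (pow_pos hs 7) (hω k)]
  exact sum_sq_add_div_le n _ _ (Real.sqrt_pos.2 hn0) (by rw [← pow_mul, ← scale_pow_eight])

theorem tendstoInMeasure_sum_proj_sq (hX : ∀ i, Measurable (X i))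
    (hident : ∀ i, IdentDistrib (X i) (X 0) P P) (hm : 1 ≤ m) (hh : Measurable h)
    (hI : Integrable (fun y => |h y| ^ (5 / 3 : ℝ)) (Measure.pi fun _ : Fin m => P.map (X 0))) :
    TendstoInMeasure P (fun n ω => (∑ k ∈ range n,
      proj h (P.map (X 0)) (X k ω) ^ 2) / (n * Real.sqrt n))
      atTop (fun _ => (0 : ℝ)) := by
  have := Measure.isProbabilityMeasure_map (hX 0).aemeasurable (μ := P)
  set F := P.map (X 0)
  have hθ : Tendsto (fun n : ℕ => theta h F ^ 2 / Real.sqrt n) atTop (𝓝 0) :=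
    tendsto_const_nhds.div_atTop (Real.tendsto_sqrt_atTop.comp tendsto_natCast_atTop_atTop)
  refine tendstoInMeasure_zero_of_le ?_ (tendstoInMeasure_add_zero
    (tendstoInMeasure_const_mul_zero 2 (tendstoInMeasure_zero_of_tendsto hθ))
    (tendstoInMeasure_const_mul_zero 2 (tendstoInMeasure_add_zero
      (tendstoInMeasure_const_mul_zero 2
        (tendstoInMeasure_condMean_truncate hX hident hm hh hI))
      (tendstoInMeasure_const_mul_zero 2 (tendstoInMeasure_sq_zero
        (tendstoInMeasure_condMean_tail hX hident hm hh hI))))))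
  filter_upwards [eventually_ge_atTop 1] with n hn
  filter_upwards [ae_forall_integrable_section hX hident hm
    (integrable_of_integrable_rpow hh hI)] with ω hω
  have hs : 0 < scale n := zero_lt_one.trans_le (one_le_scale hn)
  have hn0 : (0 : ℝ) < n := by exact_mod_cast hn
  have hsn : 0 < Real.sqrt n := Real.sqrt_pos.2 hn0
  rw [abs_of_nonneg (div_nonneg (sum_nonneg fun _ _ => sq_nonneg _) (by positivity))]
  refine le_trans ?_ (le_abs_self _)
  -- Here e = s^12 and d = n√n = s^24.
  have h1 := sum_sq_add_div_le n (fun k => condMean (truncate h (scale n ^ 7)) F (X k ω))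
    (fun k => condMean (tail h (scale n ^ 7)) F (X k ω)) (d := n * Real.sqrt n)
    (e := scale n ^ 12) (by positivity) (by
      rw [← scale_pow_eight, ← scale_pow]; ring)
  have h2 : (∑ k ∈ range n, proj h F (X k ω) ^ 2) / (n * Real.sqrt n) ≤
      2 * (theta h F ^ 2 / Real.sqrt n) +
        2 * ((∑ k ∈ range n, (condMean (truncate h (scale n ^ 7)) F (X k ω) +
          condMean (tail h (scale n ^ 7)) F (X k ω)) ^ 2) / (n * Real.sqrt n)) := by
    have h3 : 2 * (theta h F ^ 2 / Real.sqrt n) =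
        (n * (2 * theta h F ^ 2)) / (n * Real.sqrt n) := by field_simp
    rw [h3, ← mul_div_assoc, ← add_div]
    gcongr
    rw [mul_sum]
    calc _ ≤ ∑ k ∈ range n, (2 * theta h F ^ 2 +
          2 * (condMean (truncate h (scale n ^ 7)) F (X k ω) +
            condMean (tail h (scale n ^ 7)) F (X k ω)) ^ 2) := by
          refine sum_le_sum fun k _ => ?_
          rw [proj_eq_condMean_sub (hω k),
            ← condMean_eq_truncate_add_tail hh (pow_pos hs 7) (hω k)]
          nlinarith [sq_nonneg (condMean h F (X k ω) + theta h F)]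
      _ = _ := by
          rw [sum_add_distrib, sum_const, card_range, nsmul_eq_mul]
  linarith

end Limit

end UStat

theorem theorem1 {Ω : Type*} [MeasurableSpace Ω] (P : Measure Ω) [IsProbabilityMeasure P]
    (X : ℕ → Ω → ℝ) (hX : ∀ i, Measurable (X i)) (hindep : iIndepFun X P)
    (hident : ∀ i, IdentDistrib (X i) (X 0) P P)
    (m : ℕ) (hm : 1 ≤ m)
    (h : (Fin m → ℝ) → ℝ) (hmeas : Measurable h)
    (hsymm : ∀ (σ : Equiv.Perm (Fin m)) (x : Fin m → ℝ), h (fun j => x (σ j)) = h x)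
    (hmom : Integrable (fun ω => |h (fun j => X j ω)| ^ (5 / 3 : ℝ)) P)
    (hDAN : UStat.DAN P (fun i ω => UStat.proj h (P.map (X 0)) (X i ω))) :
    ∀ A ℓ : ℕ → ℝ,
      UStat.NormalAttraction P (fun i ω => UStat.proj h (P.map (X 0)) (X i ω))
        A (fun n => Real.sqrt n * ℓ n) →
      TendstoInMeasure P
        (fun (n : ℕ) (ω : Ω) =>
          |((n : ℝ) - 1) / ((m : ℝ) ^ 2 * ℓ n ^ 2) *
              ∑ i ∈ range n,
                (UStat.jackknife h n i (fun k => X k ω) - UStat.uStat h n (fun k => X k ω)) ^ 2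
            - 1 / ((n : ℝ) * ℓ n ^ 2) *
              ∑ i ∈ range n, UStat.proj h (P.map (X 0)) (X i ω) ^ 2|)
        atTop (fun _ => (0 : ℝ)) := by
  intro A ℓ hN
  have := Measure.isProbabilityMeasure_map (hX 0).aemeasurable (μ := P)
  have hI : Integrable (fun y => |h y| ^ (5 / 3 : ℝ))
      (Measure.pi fun _ : Fin m => P.map (X 0)) :=
    (UStat.integrable_tuple_iff hX hindep hident (i := fun j : Fin m => (j : ℕ))
      Fin.val_injective (hmeas.abs.pow_const _)).1 hmom
  have hi := UStat.integrable_of_integrable_rpow hmeas hI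
  obtain ⟨c, hc, hcl⟩ := UStat.NormalAttraction.exists_le
    (UStat.iIndepFun_proj hmeas hX hindep) (UStat.identDistrib_proj hmeas hX hident) hN
  refine UStat.tendstoInMeasure_zero_of_le ?_ (UStat.tendstoInMeasure_const_mul_zero (c ^ 2)⁻¹
    (UStat.tendstoInMeasure_add_zero (UStat.tendstoInMeasure_add_zero
      (UStat.tendstoInMeasure_const_mul_zero (8 * m + 4)
        (UStat.tendstoInMeasure_sum_proj_sq hX hident hm hmeas hI))
      (UStat.tendstoInMeasure_const_mul_zero 16
        (UStat.tendstoInMeasure_sum_residual_sq hX hindep hident hm hmeas hI hsymm)))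
      (UStat.tendstoInMeasure_const_mul_zero 8 (UStat.tendstoInMeasure_sq_zero
        (UStat.tendstoInMeasure_mean_proj hX hindep hident hm hmeas hi)))))
  -- The condition n ≥ 2m keeps n - m ≥ n/2, as the bounds on n(n-1)/(n-m)^2 require.
  filter_upwards [hcl, eventually_ge_atTop (2 * m)] with n hcn hn
  filter_upwards [UStat.ae_forall_integrable_section hX hident hm hi] with ω hω
  rw [abs_abs, sum_congr rfl fun k hk => by
    rw [UStat.jackknife_sub_uStat hm (by omega) (mem_range.1 hk)]]
  refine (UStat.abs_sum_sq_sub_le hm hn hc hcn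
    (θ := UStat.theta h (P.map (X 0)))
    (Y := fun k => UStat.proj h (P.map (X 0)) (X k ω))
    (R := fun k => UStat.residual h (P.map (X 0)) n k (fun k => X k ω)) (fun k => ?_)
    (UStat.uStat_eq_average hm (by omega) h (fun k => X k ω))).trans (le_abs_self _)
  -- The decomposition T_k = θ + Y_k + R_k: the conditional mean subtracted in R_k is θ + Y_k.
  rw [UStat.proj_eq_condMean_sub (hω k), UStat.residual]
  ring
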